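/- **Instances.** A *metric* $(V,d)$ is a finite set $V$ with a nonnegative rational distance $d$ that is symmetric, satisfies the triangle inequality and has $d(v,v)=0$ (distinct points may be at distance $0$). An HTSP instance is a metric $(V,d)$, a depot $r\in V$ and $k\ge 1$ vehicles with rational speeds $\lambda_i>0$; a solution consists of tours $\tau_1,\dots,\tau_k$, starting and ending at $r$, such that every vertex lies on some tour. An HVRP instance $\mathcal I$ has in addition demands $q_v\in\mathbb{Z}_{\ge 0}$ $(v\in V)$ and a vehicle capacity $Q\in\mathbb{Z}_{\ge 1}$; a solution consists of tours $\sigma_1,\dots,\sigma_k$ from $r$ to $r$ in which each vehicle starts empty, picks up items only at $r$, never carries more than $Q$ items, and in which exactly $q_v$ items in total are dropped at each $v$ (split delivery: several visits and vehicles may serve $v$). The makespan of a solution is $\max_i d(\tau_i)/\lambda_i$ (resp. $\max_i d(\sigma_i)/\lambda_i$); $\mathsf{OPT_{tsp}}$ and $\mathsf{OPT_{vrp}}$ denote the minimum makespans. Instances are given by lists of binary integers (rationals as fractions), a solution by the list of its stops (with the amounts picked up and dropped, for HVRP). *Polynomial time* means: on a random access machine with logarithmic cost, in time polynomial in the bit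 length of the input plus $\sum_{v}\lceil q_v/Q\rceil$. (The last term is at most $|V|$ if $q_v\le Q$ for all $v$; in general every HVRP solution has at least that many stops.) **Theorem.** There is an absolute constant $C$ such that for every integer $b\ge 1$ there are polynomial-time algorithms $A$ and $B$ (independent of the instance) with the following properties for every HVRP instance $\mathcal I$. Let $Q'=\min\{Q,|V|^b\}$ and $q'_v=\lceil q_vQ'/Q\rceil$ (so $Q'=Q$ and $q'=q$ whenever $Q\le |V|^b$). Let $H$ be the graph consisting of the complete graph on $V$ with edge weights $d$, together with $q'_v$ new vertices $v_1,\dots,v_{q'_v}$ for each $v\in V$ (copies of $v$), each joined to $v$ by an edge of weight $d(r,v)/Q'$. Let $\mathcal J$ be the HTSP instance on the depot $r$ and all the copies, with the shortest-path distances of $H$, and with the same $k$ vehicles and the same speeds. Then 1. $A$ computes $\mathcal J$ from $\mathcal I$, and $\mathsf{OPT_{tsp}}(\mathcal J)\le C\cdot \mathsf{OPT_{vrp}}(\mathcal I)$; 2. given $\mathcal I$ and any solution of $\mathcal J$ of makespan $M$, $B$ computes a solution of $\mathcal I$ of makespan at most $C\cdot M$. -/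

import Mathlib

open scoped ENNReal

namespace HetVRP

/-! ### Metrics, tours and makespan -/

/-- A (rational-valued) distance function that is symmetric and satisfies the triangle inequality.
Distinct points may be at distance `0`. -/
structure IsMetric {α : Type} (d : α → α → ℚ) : Prop where
  nonneg : ∀ u v, 0 ≤ d u v
  self : ∀ v, d v v = 0
  symm : ∀ u v, d u v = d v u
  triangle : ∀ u v w, d u w ≤ d u v + d v w

/-- Length of the walk through the listed points. -/
def pathLength {α : Type} (d : α → α → ℚ) : List α → ℚ
  | [] => 0
  | [_] => 0
  | u :: v :: l => d u v + pathLength d (v :: l)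

/-- The closed walk that starts at `r`, goes through the listed points and returns to `r`. -/
def closeTour {α : Type} (r : α) (l : List α) : List α := r :: (l ++ [r])

/-- `max_i len_i / speed_i` over a nonempty fleet. -/
def maxCompletion {k : ℕ} (hk : 0 < k) (len speed : Fin k → ℚ) : ℚ :=
  Finset.univ.sup' ⟨⟨0, hk⟩, Finset.mem_univ _⟩ fun i => len i / speed i

/-! ### Heterogeneous TSP -/

/-- An instance of Heterogeneous TSP on the points `Fin n` with `k` vehicles. -/
structure HTSP where
  n : ℕ
  d : Fin n → Fin n → ℚ
  metric : IsMetric d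
  depot : Fin n
  k : ℕ
  k_pos : 0 < k
  speed : Fin k → ℚ
  speed_pos : ∀ i, 0 < speed i

/-- A solution: for each vehicle the vertices it visits between leaving the depot and
returning to it. -/
abbrev HTSP.Solution (J : HTSP) : Type := Fin J.k → List (Fin J.n)

/-- Every vertex lies on some tour. -/
def HTSP.Feasible (J : HTSP) (τ : J.Solution) : Prop :=
  ∀ v, ∃ i, v ∈ closeTour J.depot (τ i)

def HTSP.makespan (J : HTSP) (τ : J.Solution) : ℚ :=
  maxCompletion J.k_pos (fun i => pathLength J.d (closeTour J.depot (τ i))) J.speed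

/-- The optimum (`⊤` if there were no feasible solution). -/
noncomputable def HTSP.opt (J : HTSP) : ℝ≥0∞ :=
  ⨅ (τ : J.Solution) (_ : J.Feasible τ), ENNReal.ofReal (J.makespan τ : ℝ)

/-! ### Heterogeneous capacitated vehicle routing, split delivery -/

/-- An instance of Heterogeneous CVRP: vertex `v` demands `q v` units, each vehicle has
capacity `Q`. -/
structure HVRP where
  n : ℕ
  d : Fin n → Fin n → ℚ
  metric : IsMetric d
  depot : Fin n
  q : Fin n → ℕ
  Q : ℕ
  Q_pos : 0 < Q
  k : ℕ
  k_pos : 0 < k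
  speed : Fin k → ℚ
  speed_pos : ∀ i, 0 < speed i

/-- One stop of a vehicle: it first picks up `pick` units and then drops `drop` units. -/
structure Stop (n : ℕ) where
  vertex : Fin n
  pick : ℕ
  drop : ℕ

/-- A solution: for each vehicle its stops between the start at the depot and the return to it. -/
abbrev HVRP.Solution (I : HVRP) : Type := Fin I.k → List (Stop I.n)

/-- A vehicle that currently carries `load` units can perform the listed stops: it picks up only
at the depot, never carries more than `Q` units, and drops only what it carries. -/
def HVRP.Carries (I : HVRP) : ℕ → List (Stop I.n) → Prop
  | _, [] => True
  | load, s :: l =>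
      (s.pick ≠ 0 → s.vertex = I.depot) ∧ load + s.pick ≤ I.Q ∧ s.drop ≤ load + s.pick ∧
        I.Carries (load + s.pick - s.drop) l

/-- Units dropped at `v` along the listed stops. -/
def delivered {n : ℕ} (v : Fin n) (l : List (Stop n)) : ℕ :=
  ((l.filter fun s => s.vertex = v).map Stop.drop).sum

/-- Every vehicle starts empty and respects the capacity, and each demand is met exactly,
possibly by several visits of several vehicles. -/
def HVRP.Feasible (I : HVRP) (σ : I.Solution) : Prop :=
  (∀ i, I.Carries 0 (σ i)) ∧ ∀ v, ∑ i, delivered v (σ i) = I.q v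

def HVRP.makespan (I : HVRP) (σ : I.Solution) : ℚ :=
  maxCompletion I.k_pos
    (fun i => pathLength I.d (closeTour I.depot ((σ i).map Stop.vertex))) I.speed

/-- The optimum (`⊤` if there were no feasible solution). -/
noncomputable def HVRP.opt (I : HVRP) : ℝ≥0∞ :=
  ⨅ (σ : I.Solution) (_ : I.Feasible σ), ENNReal.ofReal (I.makespan σ : ℝ)

/-! ### The graph with demand copies -/

/-- Vertices of the augmented graph: the original ones and, for each `v`, `q v` copies of `v`. -/
abbrev CopyVertex (I : HVRP) (q : Fin I.n → ℕ) : Type := Fin I.n ⊕ (Σ v : Fin I.n, Fin (q v))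

/-- Weighted edges of the augmented graph: the complete graph on the original vertices with
weights `d`, and an edge of weight `d(r,v)/Q` between `v` and each of its copies. -/
inductive CopyEdge (I : HVRP) (q : Fin I.n → ℕ) (Q : ℕ) :
    CopyVertex I q → CopyVertex I q → ℚ → Prop
  | base (u v : Fin I.n) (h : u ≠ v) : CopyEdge I q Q (Sum.inl u) (Sum.inl v) (I.d u v)
  | toCopy (v : Fin I.n) (p : Fin (q v)) :
      CopyEdge I q Q (Sum.inl v) (Sum.inr ⟨v, p⟩) (I.d I.depot v / Q)
  | fromCopy (v : Fin I.n) (p : Fin (q v)) :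
      CopyEdge I q Q (Sum.inr ⟨v, p⟩) (Sum.inl v) (I.d I.depot v / Q)

/-- `CopyWalk I q Q a b w`: some walk from `a` to `b` in the augmented graph has length `w`. -/
inductive CopyWalk (I : HVRP) (q : Fin I.n → ℕ) (Q : ℕ) :
    CopyVertex I q → CopyVertex I q → ℚ → Prop
  | nil (a : CopyVertex I q) : CopyWalk I q Q a a 0
  | cons {a b c : CopyVertex I q} {x y : ℚ} (h : CopyEdge I q Q a b x)
      (t : CopyWalk I q Q b c y) : CopyWalk I q Q a c (x + y)

/-- The points of the reduced instance as vertices of the augmented graph: the depot (`none`)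
and all copies. -/
def copyPoint (I : HVRP) (q : Fin I.n → ℕ) : Option (Σ v : Fin I.n, Fin (q v)) → CopyVertex I q
  | none => Sum.inl I.depot
  | some x => Sum.inr x

/-- Up to the numbering `e` of its points, `J` is the Heterogeneous TSP instance on the depot and
all demand copies (for demands `q` and capacity `Q`), with the shortest-path metric of the
augmented graph and with the vehicles of `I`. -/
def IsCopyInstance (I : HVRP) (q : Fin I.n → ℕ) (Q : ℕ) (J : HTSP) : Prop :=
  (∃ e : Fin J.n ≃ Option (Σ v : Fin I.n, Fin (q v)),
    e J.depot = none ∧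
    ∀ i j, IsLeast {w | CopyWalk I q Q (copyPoint I q (e i)) (copyPoint I q (e j)) w} (J.d i j)) ∧
  ∃ hk : J.k = I.k, ∀ i, J.speed i = I.speed (Fin.cast hk i)

/-- Capacity after scaling down to at most `n ^ b`; nothing changes if `Q ≤ n ^ b` already. -/
def HVRP.scaledCapacity (I : HVRP) (b : ℕ) : ℕ := min I.Q (I.n ^ b)

/-- Demands after the same scaling, rounded up; nothing changes if `Q ≤ n ^ b`. -/
def HVRP.scaledDemand (I : HVRP) (b : ℕ) (v : Fin I.n) : ℕ :=
  ⌈(I.q v : ℚ) * I.scaledCapacity b / I.Q⌉₊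

/-! ### Random access machines with logarithmic cost -/

/-- Memory state: finitely many registers are named by a program, the memory is addressed
indirectly, and the output tape can only be appended to. -/
structure Store where
  reg : ℕ → ℕ
  mem : ℕ → ℕ
  out : List ℕ

/-- Arithmetic expressions over natural numbers. -/
inductive Expr
  | const (c : ℕ)
  | reg (i : ℕ)
  | load (a : Expr)
  | add (x y : Expr)
  | sub (x y : Expr)
  | mul (x y : Expr)
  | div (x y : Expr)
  | lt (x y : Expr)

/-- Value of an expression; `sub` is truncated, `div` rounds down, `lt` is `1` or `0`. -/
def Expr.eval (s : Store) : Expr → ℕ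
  | .const c => c
  | .reg i => s.reg i
  | .load a => s.mem (a.eval s)
  | .add x y => x.eval s + y.eval s
  | .sub x y => x.eval s - y.eval s
  | .mul x y => x.eval s * y.eval s
  | .div x y => x.eval s / y.eval s
  | .lt x y => if x.eval s < y.eval s then 1 else 0

/-- Logarithmic cost: every operation costs one plus the bit length of its result; the operands,
including addresses, are charged where they are computed. -/
def Expr.cost (s : Store) : Expr → ℕ
  | .const c => 1 + c.size
  | .reg i => 1 + (s.reg i).size
  | .load a => a.cost s + (1 + (s.mem (a.eval s)).size)
  | .add x y => x.cost s + y.cost s + (1 + (x.eval s + y.eval s).size)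
  | .sub x y => x.cost s + y.cost s + (1 + (x.eval s - y.eval s).size)
  | .mul x y => x.cost s + y.cost s + (1 + (x.eval s * y.eval s).size)
  | .div x y => x.cost s + y.cost s + (1 + (x.eval s / y.eval s).size)
  | .lt x y => x.cost s + y.cost s + 2

/-- Programs. -/
inductive Prog
  | skip
  | assign (i : ℕ) (x : Expr)
  | store (a x : Expr)
  | write (x : Expr)
  | seq (c₁ c₂ : Prog)
  | ite (x : Expr) (c₁ c₂ : Prog)
  | loop (x : Expr) (c : Prog)

/-- `Exec c s s' t`: started in `s`, the program `c` halts in `s'` after total cost `t`.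
A test succeeds if its value is nonzero. -/
inductive Exec : Prog → Store → Store → ℕ → Prop
  | skip (s : Store) : Exec .skip s s 1
  | assign (i : ℕ) (x : Expr) (s : Store) :
      Exec (.assign i x) s { s with reg := Function.update s.reg i (x.eval s) } (1 + x.cost s)
  | store (a x : Expr) (s : Store) :
      Exec (.store a x) s { s with mem := Function.update s.mem (a.eval s) (x.eval s) }
        (1 + a.cost s + x.cost s)
  | write (x : Expr) (s : Store) :
      Exec (.write x) s { s with out := s.out ++ [x.eval s] } (1 + x.cost s)
  | seq {c₁ c₂ : Prog} {s s' s'' : Store} {t₁ t₂ : ℕ} (h₁ : Exec c₁ s s' t₁)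
      (h₂ : Exec c₂ s' s'' t₂) : Exec (.seq c₁ c₂) s s'' (t₁ + t₂)
  | iteTrue {x : Expr} {c₁ c₂ : Prog} {s s' : Store} {t : ℕ} (hx : x.eval s ≠ 0)
      (h : Exec c₁ s s' t) : Exec (.ite x c₁ c₂) s s' (1 + x.cost s + t)
  | iteFalse {x : Expr} {c₁ c₂ : Prog} {s s' : Store} {t : ℕ} (hx : x.eval s = 0)
      (h : Exec c₂ s s' t) : Exec (.ite x c₁ c₂) s s' (1 + x.cost s + t)
  | loopDone {x : Expr} {c : Prog} {s : Store} (hx : x.eval s = 0) :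
      Exec (.loop x c) s s (1 + x.cost s)
  | loopStep {x : Expr} {c : Prog} {s s' s'' : Store} {t₁ t₂ : ℕ} (hx : x.eval s ≠ 0)
      (h₁ : Exec c s s' t₁) (h₂ : Exec (.loop x c) s' s'' t₂) :
      Exec (.loop x c) s s'' (1 + x.cost s + t₁ + t₂)

/-- Initially the input occupies the first memory cells, register `0` holds the number of input
words, and everything else is zero. -/
def initStore (w : List ℕ) : Store where
  reg := fun i => if i = 0 then w.length else 0
  mem := fun a => w.getD a 0
  out := []

/-- On input `w` the program `P` halts within cost `T` and has written `o`. -/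
def Prog.OutputsWithin (P : Prog) (w o : List ℕ) (T : ℕ) : Prop :=
  ∃ s t, Exec P (initStore w) s t ∧ s.out = o ∧ t ≤ T

/-! ### Encodings -/

/-- Bit length of a list of numbers written in binary, with one separator each. -/
def bitLength (w : List ℕ) : ℕ := (w.map fun x => x.size + 1).sum

/-- The fraction `x.1 / x.2` of natural numbers (not necessarily reduced) is a code of `z`. -/
def IsFrac (x : ℕ × ℕ) (z : ℚ) : Prop := x.2 ≠ 0 ∧ z = (x.1 : ℚ) / x.2

/-- All entries of a vector of fractions, in order. -/
def codeVector {k : ℕ} (f : Fin k → ℕ × ℕ) : List ℕ :=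
  (List.finRange k).flatMap fun i => [(f i).1, (f i).2]

/-- All entries of a square matrix of fractions, row by row. -/
def codeMatrix {n : ℕ} (f : Fin n → Fin n → ℕ × ℕ) : List ℕ :=
  (List.finRange n).flatMap fun i => codeVector (f i)

/-- The list `w` describes the instance `J`: sizes, depot, distances, speeds. -/
def HTSP.IsCode (J : HTSP) (w : List ℕ) : Prop :=
  ∃ (D : Fin J.n → Fin J.n → ℕ × ℕ) (S : Fin J.k → ℕ × ℕ),
    (∀ u v, IsFrac (D u v) (J.d u v)) ∧ (∀ i, IsFrac (S i) (J.speed i)) ∧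
    w = [J.n, J.k, (J.depot : ℕ)] ++ codeMatrix D ++ codeVector S

/-- The list `w` describes the instance `I`: sizes, depot, capacity, demands, distances, speeds. -/
def HVRP.IsCode (I : HVRP) (w : List ℕ) : Prop :=
  ∃ (D : Fin I.n → Fin I.n → ℕ × ℕ) (S : Fin I.k → ℕ × ℕ),
    (∀ u v, IsFrac (D u v) (I.d u v)) ∧ (∀ i, IsFrac (S i) (I.speed i)) ∧
    w = [I.n, I.k, (I.depot : ℕ), I.Q] ++ List.ofFn I.q ++ codeMatrix D ++ codeVector S

/-- Code of a solution: for each vehicle the number of visits, then the visited vertices. -/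
def HTSP.codeSolution (J : HTSP) (τ : J.Solution) : List ℕ :=
  (List.finRange J.k).flatMap fun i => (τ i).length :: (τ i).map fun v => (v : ℕ)

/-- Code of a solution: for each vehicle the number of stops, then the stops. -/
def HVRP.codeSolution (I : HVRP) (σ : I.Solution) : List ℕ :=
  (List.finRange I.k).flatMap fun i =>
    (σ i).length :: (σ i).flatMap fun s => [(s.vertex : ℕ), s.pick, s.drop]

/-- Total number of vehicle loads demanded, `∑ ⌈q_v / Q⌉`. It is at most `n` if no demand exceeds
the capacity. One stop drops at most `Q` units, so every feasible solution has at least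
`⌈q_v / Q⌉` stops at `v`, all of which have to be written down. -/
def HVRP.loads (I : HVRP) : ℕ := ∑ v, ⌈(I.q v : ℚ) / I.Q⌉₊

end HetVRP

open HetVRP

/-! Write Q' for the scaled capacity, d(r,v) for the distance from the depot to v, and m = ⌈Q/Q'⌉
for `copyLoad`. A copy of v represents up to m units at v, and its pendant edge of length d(r,v)/Q'
charges for the share of a depot round trip that those units use up. Capacity thus turns into extra
length, and an ordinary tour problem remains.

From deliveries to copies (`exists_reduced_solution`, factor 5): a vehicle that drops x units at v
receives at most ⌈xQ'/Q⌉ copies of v. Rounding up is subadditive, so these quotas suffice for all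
copies. Let D be the length of the vehicle's tour. Each unit has been carried at least as far as
from the depot and at most Q units travel together, so the sum of x·d(r,v)/Q over all v is at most D
(`sum_drop_le`). Rounding costs nothing if Q' = Q. Otherwise Q' ≥ n, and at most n vertices lose at
most one copy each, of pendant length at most D/Q': again at most D (`exists_rounding`). Pendant
edges are walked twice, so the new tour has length at most D + 2(D + D).

From copies to deliveries (`feasible_expand`, `makespan_expand_le`, factor 8): each vehicle follows
its tour in the original metric, drops a copy's units when that copy is first visited, and fills up
at the depot whenever it carries fewer than m units. The detours are paid by the potential 4·((Q -
load)/Q)·d(r, position) (`pathLength_route_le`). Dropping up to m ≤ 2Q/Q' units raises it by at most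
8 pendant lengths, moving raises it by at most 4 times the distance, and at a refill it covers the
round trip (`refill_le`).

The shortest-path metric has the closed form `copyDist`, so both conversions are explicit formulas
with simple loops over the copies. Their number is at most 1 + loads·n^b (`reduced_n_le`). Programs
are verified with `Runs`, a total-correctness predicate that also bounds the cost: if all stored
numbers have at most S bits and every loop makes at most S rounds, the cost is polynomial in S with
exponent given by the loop nesting. -/

namespace HetVRP

/-! ### Walks in a metric -/

section Walks

variable {α β : Type} {d : α → α → ℚ}

lemma pathLength_cons_cons (u v : α) (l : List α) :
    pathLength d (u :: v :: l) = d u v + pathLength d (v :: l) := rfl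

lemma IsMetric.pathLength_nonneg (h : IsMetric d) : ∀ l, 0 ≤ pathLength d l
  | [] => le_rfl
  | [_] => le_rfl
  | u :: v :: l => add_nonneg (h.nonneg u v) (h.pathLength_nonneg (v :: l))

lemma IsMetric.pathLength_cons_le (h : IsMetric d) (u v w : α) (l : List α) :
    pathLength d (u :: w :: l) ≤ d u v + pathLength d (v :: w :: l) := by
  have := h.triangle u v w
  simp only [pathLength_cons_cons]
  linarith

lemma IsMetric.pathLength_sublist (h : IsMetric d) (r : α) {l' l : List α} (hl : l'.Sublist l)
    (u : α) : pathLength d (u :: l' ++ [r]) ≤ pathLength d (u :: l ++ [r]) := by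
  induction hl generalizing u with
  | slnil => exact le_rfl
  | @cons l₁ l₂ v _ ih =>
    refine le_trans ?_ (add_le_add_right (ih v) (d u v))
    cases l₁ <;> exact h.pathLength_cons_le ..
  | cons_cons v _ ih => exact add_le_add_right (ih v) (d u v)

lemma IsMetric.dist_le_pathLength (h : IsMetric d) (r : α) {v : α} {l : List α} (hv : v ∈ l)
    (u : α) : d u v ≤ pathLength d (u :: l ++ [r]) := by
  have h₁ := h.pathLength_sublist r (List.singleton_sublist.2 hv) u
  have h₂ := h.nonneg v r
  simp only [List.cons_append, List.nil_append, pathLength] at h₁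
  simp only [List.cons_append] at h₁ ⊢
  linarith

lemma IsMetric.pathLength_replicate (h : IsMetric d) (v w : α) (l : List α) :
    ∀ (c : ℕ) (u : α), pathLength d (u :: (List.replicate c v ++ w :: l)) ≤
      pathLength d (u :: v :: w :: l)
  | 0, u => h.pathLength_cons_le ..
  | c + 1, u => by
    have := h.pathLength_replicate v w l c v
    simp only [List.replicate_succ, List.cons_append, pathLength_cons_cons] at this ⊢
    rw [h.self] at this
    linarith

/-- Repeating a vertex is free because d(v,v) = 0, and multiplicity 0 is a shortcut. The
multiplicities will be the numbers of copies visited at each vertex. -/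
lemma IsMetric.pathLength_flatMap_replicate (h : IsMetric d) (r : α) (c : α → ℕ) (l : List α)
    (u : α) : pathLength d (u :: l.flatMap (fun v => List.replicate (c v) v) ++ [r]) ≤
      pathLength d (u :: l ++ [r]) := by
  induction l generalizing u with
  | nil => exact le_rfl
  | cons v l ih =>
    have h₁ := ih v
    simp only [List.flatMap_cons, List.cons_append, List.append_assoc] at h₁ ⊢
    obtain ⟨w, t, ht⟩ : ∃ w t,
        l.flatMap (fun v => List.replicate (c v) v) ++ [r] = w :: t := by
      cases l.flatMap (fun v => List.replicate (c v) v) <;> simp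
    rw [ht] at h₁ ⊢
    refine (h.pathLength_replicate v w t (c v) u).trans ?_
    rw [pathLength_cons_cons, pathLength_cons_cons u v]
    linarith

/-- Walking to points hanging off base points costs the walk along the base points plus twice
the pendant distances. -/
lemma pathLength_pendant_le {δ : β → β → ℚ} {π : β → α} {a : β → ℚ}
    (hδ : ∀ x y, δ x y ≤ a x + d (π x) (π y) + a y) (z : β) (l : List β) (x : β) :
    pathLength δ (x :: l ++ [z]) ≤
      pathLength d (π x :: l.map π ++ [π z]) + 2 * (l.map a).sum + a x + a z := by
  induction l generalizing x with
  | nil =>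
    have := hδ x z
    simp only [List.cons_append, List.nil_append, List.map_nil, pathLength, List.sum_nil]
    linarith
  | cons y l ih =>
    have h₁ := ih y
    have h₂ := hδ x y
    simp only [List.cons_append, List.map_cons, List.sum_cons, pathLength_cons_cons] at h₁ ⊢
    linarith

/-- Projected to the base points, the walk through all the groups `f v` is the walk `l` with
repetitions and omissions, hence no longer than `l`; only the pendant edges, each used twice, come
on top. -/
lemma IsMetric.pathLength_flatMap_pendant_le (h : IsMetric d) {δ : β → β → ℚ} {π : β → α}
    {a : β → ℚ} (hδ : ∀ x y, δ x y ≤ a x + d (π x) (π y) + a y) {f : α → List β}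
    (hf : ∀ v, ∀ x ∈ f v, π x = v) (z : β) (hz : a z = 0) (l : List α) :
    pathLength δ (z :: l.flatMap f ++ [z]) ≤
      pathLength d (π z :: l ++ [π z]) + 2 * (l.map fun v => ((f v).map a).sum).sum := by
  have h₁ := pathLength_pendant_le hδ z (l.flatMap f) z
  have h₂ := h.pathLength_flatMap_replicate (π z) (fun v => (f v).length) l (π z)
  have h₃ : (l.flatMap f).map π = l.flatMap fun v => List.replicate (f v).length v := by
    rw [List.map_flatMap]
    congr 1
    funext v
    exact List.eq_replicate_iff.2 ⟨by simp, by simpa using hf v⟩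
  have h₄ : ((l.flatMap f).map a).sum = (l.map fun v => ((f v).map a).sum).sum := by
    rw [List.map_flatMap, List.flatMap, List.sum_flatten, List.map_map]
    rfl
  rw [h₃, h₄, hz] at h₁
  linarith

/-- Attaching each point `x` to a base point `π x` by a pendant edge of length `a x`. -/
lemma IsMetric.pendant [DecidableEq β] (h : IsMetric d) (π : β → α) {a : β → ℚ}
    (ha : ∀ x, 0 ≤ a x) :
    IsMetric fun x y => if x = y then 0 else a x + d (π x) (π y) + a y where
  nonneg x y := by
    have := h.nonneg (π x) (π y); have := ha x; have := ha y
    split_ifs <;> linarith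
  self x := by simp
  symm x y := by
    simp only [eq_comm (a := x), h.symm (π x)]
    split_ifs <;> ring
  triangle x y z := by
    have h₁ := h.triangle (π x) (π y) (π z); have := ha x; have := ha y; have := ha z
    have := h.nonneg (π x) (π y); have := h.nonneg (π y) (π z)
    have := h.symm (π x) (π y)
    by_cases hxy : x = y
    · subst hxy; simp
    by_cases hyz : y = z
    · subst hyz; simp
    simp only [hxy, hyz, if_false]
    split_ifs <;> linarith

end Walks

lemma maxCompletion_le {k : ℕ} (hk : 0 < k) {len len' speed : Fin k → ℚ}
    (hs : ∀ i, 0 < speed i) {C : ℚ} (hC : 0 ≤ C) (h : ∀ i, len i ≤ C * len' i) :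
    maxCompletion hk len speed ≤ C * maxCompletion hk len' speed := by
  refine Finset.sup'_le _ _ fun i _ => ?_
  calc len i / speed i ≤ C * (len' i / speed i) := by
        rw [← mul_div_assoc]
        exact div_le_div_of_nonneg_right (h i) (hs i).le
    _ ≤ _ := mul_le_mul_of_nonneg_left
        (Finset.le_sup' (fun i => len' i / speed i) (Finset.mem_univ i)) hC

/-! ### The reduced instance -/

section CopyInstance

variable (I : HVRP) (q : Fin I.n → ℕ) (Q : ℕ)

/-- The original vertex below a vertex of the augmented graph. -/
def baseVertex : CopyVertex I q → Fin I.n := Sum.elim id Sigma.fst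

/-- Length of the edge between a copy and its vertex. -/
def pendantLength : CopyVertex I q → ℚ := Sum.elim (fun _ => 0) fun x => I.d I.depot x.1 / Q

lemma pendantLength_nonneg (x : CopyVertex I q) : 0 ≤ pendantLength I q Q x := by
  cases x with
  | inl v => exact le_rfl
  | inr x => exact div_nonneg (I.metric.nonneg _ _) (Nat.cast_nonneg _)

/-- The shortest-path distance of the augmented graph. -/
def copyDist (x y : CopyVertex I q) : ℚ :=
  if x = y then 0
  else pendantLength I q Q x + I.d (baseVertex I q x) (baseVertex I q y) + pendantLength I q Q y

lemma isMetric_copyDist : IsMetric (copyDist I q Q) :=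
  I.metric.pendant (baseVertex I q) (pendantLength_nonneg I q Q)

variable {I q Q}

lemma CopyEdge.eq_copyDist {x y : CopyVertex I q} {w : ℚ} (h : CopyEdge I q Q x y w) :
    w = copyDist I q Q x y := by
  cases h <;> simp [copyDist, pendantLength, baseVertex, I.metric.self, *]

lemma CopyWalk.copyDist_le {x y : CopyVertex I q} {w : ℚ} (h : CopyWalk I q Q x y w) :
    copyDist I q Q x y ≤ w := by
  induction h with
  | nil a => exact ((isMetric_copyDist I q Q).self a).le
  | cons h t ih =>
    rw [h.eq_copyDist]
    exact ((isMetric_copyDist I q Q).triangle _ _ _).trans (add_le_add_right ih _)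

lemma CopyWalk.append {x y z : CopyVertex I q} {w w' : ℚ} (h : CopyWalk I q Q x y w)
    (h' : CopyWalk I q Q y z w') : CopyWalk I q Q x z (w + w') := by
  induction h with
  | nil a => simpa using h'
  | cons h t ih => rw [add_assoc]; exact .cons h (ih h')

lemma copyWalk_to_base (x : CopyVertex I q) :
    CopyWalk I q Q x (Sum.inl (baseVertex I q x)) (pendantLength I q Q x) := by
  cases x with
  | inl v => exact .nil _
  | inr x => simpa [pendantLength, baseVertex] using CopyWalk.cons (.fromCopy x.1 x.2) (.nil _)

lemma copyWalk_from_base (x : CopyVertex I q) :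
    CopyWalk I q Q (Sum.inl (baseVertex I q x)) x (pendantLength I q Q x) := by
  cases x with
  | inl v => exact .nil _
  | inr x => simpa [pendantLength, baseVertex] using CopyWalk.cons (.toCopy x.1 x.2) (.nil _)

lemma copyWalk_base (u v : Fin I.n) :
    CopyWalk I q Q (Sum.inl u) (Sum.inl v) (I.d u v) := by
  by_cases h : u = v
  · subst h; rw [I.metric.self]; exact .nil _
  · simpa using CopyWalk.cons (.base u v h) (.nil _)

/-- Every edge weight equals `copyDist` of its ends and `copyDist` satisfies the triangle
inequality, so no walk is shorter. The walk down to the base vertex, across, and up to the target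
attains it. -/
lemma isLeast_copyDist (x y : CopyVertex I q) :
    IsLeast {w | CopyWalk I q Q x y w} (copyDist I q Q x y) := by
  refine ⟨?_, fun w hw => CopyWalk.copyDist_le hw⟩
  by_cases h : x = y
  · subst h
    simpa [copyDist] using CopyWalk.nil (I := I) (Q := Q) x
  · simpa [copyDist, h] using
      ((copyWalk_to_base x).append (copyWalk_base _ _)).append (copyWalk_from_base y)

variable (I q Q)

/-- The points of the reduced instance, in the order in which they are numbered. -/
def copyList : List (Option (Σ v : Fin I.n, Fin (q v))) :=
  none :: (List.finRange I.n).flatMap fun v => (List.finRange (q v)).map fun p => some ⟨v, p⟩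

lemma nodup_copyList : (copyList I q).Nodup := by
  refine List.nodup_cons.2 ⟨by simp, List.nodup_flatMap.2 ⟨fun v _ => ?_, ?_⟩⟩
  · refine (List.nodup_finRange _).map fun p p' h => ?_
    simpa using h
  · refine (List.nodup_finRange _).imp fun {u v} huv => ?_
    simp only [Function.onFun, List.disjoint_left, List.mem_map, not_exists, not_and,
      forall_exists_index, and_imp]
    rintro _ p - rfl p' - h
    exact huv (congrArg Sigma.fst (Option.some.inj h)).symm

lemma mem_copyList (x : Option (Σ v : Fin I.n, Fin (q v))) : x ∈ copyList I q := by
  rcases x with _ | ⟨v, p⟩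
  · exact List.mem_cons_self
  · exact List.mem_cons_of_mem _ (List.mem_flatMap.2
      ⟨v, List.mem_finRange v, List.mem_map.2 ⟨p, List.mem_finRange p, rfl⟩⟩)

/-- The numbering of the points of the reduced instance. -/
def copyEquiv : Fin (copyList I q).length ≃ Option (Σ v : Fin I.n, Fin (q v)) :=
  (nodup_copyList I q).getEquivOfForallMemList _ (mem_copyList I q)

lemma copyPoint_injective : Function.Injective (copyPoint I q) := by
  rintro (_ | x) (_ | y) h <;> simp_all [copyPoint]

/-- The reduced instance. -/
def copyInstance : HTSP where
  n := (copyList I q).length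
  d i j := copyDist I q Q (copyPoint I q (copyEquiv I q i)) (copyPoint I q (copyEquiv I q j))
  metric :=
    let h := isMetric_copyDist I q Q
    ⟨fun _ _ => h.nonneg _ _, fun _ => h.self _, fun _ _ => h.symm _ _,
      fun _ _ _ => h.triangle _ _ _⟩
  depot := ⟨0, by simp [copyList]⟩
  k := I.k
  k_pos := I.k_pos
  speed := I.speed
  speed_pos := I.speed_pos

lemma isCopyInstance_copyInstance : IsCopyInstance I q Q (copyInstance I q Q) :=
  ⟨⟨copyEquiv I q, rfl, fun _ _ => isLeast_copyDist _ _⟩, rfl, fun _ => rfl⟩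

/-- The numbering of the points of the reduced instance, as a map from its points. -/
def pointEquiv : Fin (copyInstance I q Q).n ≃ Option (Σ v : Fin I.n, Fin (q v)) := copyEquiv I q

/-- The original vertex of a point of the reduced instance. -/
def pointVertex (i : Fin (copyInstance I q Q).n) : Fin I.n :=
  baseVertex I q (copyPoint I q (pointEquiv I q Q i))

/-- The distance between a point of the reduced instance and its original vertex. -/
def pointPendant (i : Fin (copyInstance I q Q).n) : ℚ :=
  I.d I.depot (pointVertex I q Q i) / Q

/-- The depot needs no special case: d(r,r)/Q = 0 is its pendant length. -/
lemma pointPendant_eq (i : Fin (copyInstance I q Q).n) :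
    pointPendant I q Q i = pendantLength I q Q (copyPoint I q (pointEquiv I q Q i)) := by
  unfold pointPendant pointVertex
  rcases pointEquiv I q Q i with _ | x
  · simp [copyPoint, pendantLength, baseVertex, I.metric.self]
  · rfl

lemma pointPendant_nonneg (i : Fin (copyInstance I q Q).n) : 0 ≤ pointPendant I q Q i :=
  div_nonneg (I.metric.nonneg _ _) (Nat.cast_nonneg _)

lemma copyInstance_d (i j : Fin (copyInstance I q Q).n) :
    (copyInstance I q Q).d i j =
      if i = j then 0
      else pointPendant I q Q i + I.d (pointVertex I q Q i) (pointVertex I q Q j) +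
        pointPendant I q Q j := by
  have h : copyPoint I q (pointEquiv I q Q i) = copyPoint I q (pointEquiv I q Q j) ↔ i = j :=
    ((copyPoint_injective I q).comp (pointEquiv I q Q).injective).eq_iff
  simp only [pointPendant_eq, pointVertex, ← h]
  rfl

lemma pointVertex_depot : pointVertex I q Q (copyInstance I q Q).depot = I.depot := rfl

lemma pointPendant_depot : pointPendant I q Q (copyInstance I q Q).depot = 0 := by
  rw [pointPendant, pointVertex_depot, I.metric.self, zero_div]

/-- The number of the `p`-th copy of `v`. -/
def copyIndex (v : Fin I.n) (p : Fin (q v)) : Fin (copyInstance I q Q).n :=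
  (pointEquiv I q Q).symm (some ⟨v, p⟩)

lemma pointVertex_copyIndex (v : Fin I.n) (p : Fin (q v)) :
    pointVertex I q Q (copyIndex I q Q v p) = v := by
  simp [pointVertex, copyIndex, copyPoint, baseVertex]

lemma eq_depot_or_copyIndex (i : Fin (copyInstance I q Q).n) :
    i = (copyInstance I q Q).depot ∨ ∃ v p, i = copyIndex I q Q v p := by
  rcases h : pointEquiv I q Q i with _ | ⟨v, p⟩
  · exact .inl ((pointEquiv I q Q).injective h)
  · exact .inr ⟨v, p, by rw [copyIndex, ← h, Equiv.symm_apply_apply]⟩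

end CopyInstance

/-! ### Scaling -/

lemma ceil_div_eq_ceilDiv (a : ℕ) {b : ℕ} (hb : 0 < b) : ⌈(a : ℚ) / b⌉₊ = (a + b - 1) / b := by
  rw [← Nat.ceilDiv_eq_add_pred_div]
  refine eq_of_forall_ge_iff fun c => ?_
  rw [Nat.ceil_le, div_le_iff₀ (by exact_mod_cast hb), ceilDiv_le_iff_le_mul hb, mul_comm]
  exact_mod_cast Iff.rfl

lemma sum_min_tsub (m q K : ℕ) :
    ∑ p ∈ Finset.range K, min m (q - p * m) = min (K * m) q := by
  induction K with
  | zero => simp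
  | succ K ih =>
    rw [Finset.sum_range_succ, ih, Nat.succ_mul]
    omega

namespace HVRP

variable (I : HVRP) (b : ℕ)

lemma n_pos : 0 < I.n := I.depot.pos

lemma scaledCapacity_pos : 0 < I.scaledCapacity b :=
  lt_min I.Q_pos (pow_pos I.n_pos b)

lemma scaledCapacity_le : I.scaledCapacity b ≤ I.Q := min_le_left _ _

/-- The dichotomy behind all rounding estimates: either nothing is scaled, or the scaled capacity is
large enough to absorb one rounding error per vertex. Here `1 ≤ b` is essential. -/
lemma scaledCapacity_eq_or_le (hb : 1 ≤ b) :
    I.scaledCapacity b = I.Q ∨ I.n ≤ I.scaledCapacity b := by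
  rcases le_total I.Q (I.n ^ b) with h | h
  · exact .inl (min_eq_left h)
  · right
    rw [scaledCapacity, min_eq_right h]
    exact Nat.le_self_pow (by omega) _

lemma scaledDemand_eq (v : Fin I.n) :
    I.scaledDemand b v = (I.q v * I.scaledCapacity b + I.Q - 1) / I.Q := by
  rw [← ceil_div_eq_ceilDiv _ I.Q_pos, scaledDemand]
  push_cast
  rfl

/-- The number of units that one copy stands for. -/
def copyLoad : ℕ := (I.Q + I.scaledCapacity b - 1) / I.scaledCapacity b

lemma le_copyLoad_mul : I.Q ≤ I.copyLoad b * I.scaledCapacity b := by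
  rw [mul_comm, ← ceilDiv_le_iff_le_mul (I.scaledCapacity_pos b), Nat.ceilDiv_eq_add_pred_div]
  rfl

lemma copyLoad_mul_lt : I.copyLoad b * I.scaledCapacity b < I.Q + I.scaledCapacity b := by
  have h := Nat.div_mul_le_self (I.Q + I.scaledCapacity b - 1) (I.scaledCapacity b)
  have := I.Q_pos
  unfold copyLoad
  omega

lemma copyLoad_le : I.copyLoad b ≤ I.Q := by
  have h₁ := I.copyLoad_mul_lt b
  have h₂ := I.scaledCapacity_pos b
  by_contra! h
  nlinarith

/-- With m and Q' the load of a copy and the scaled capacity, q·Q' ≤ Q·q' ≤ m·Q'·q'; cancel Q'. So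
the copies have room for the whole demand. -/
lemma demand_le (v : Fin I.n) : I.q v ≤ I.scaledDemand b v * I.copyLoad b := by
  have h₁ : I.q v * I.scaledCapacity b ≤ I.Q * I.scaledDemand b v := by
    rw [← ceilDiv_le_iff_le_mul I.Q_pos, Nat.ceilDiv_eq_add_pred_div, scaledDemand_eq]
  have h₂ := I.le_copyLoad_mul b
  refine Nat.le_of_mul_le_mul_right ?_ (I.scaledCapacity_pos b)
  calc I.q v * I.scaledCapacity b ≤ I.Q * I.scaledDemand b v := h₁
    _ ≤ I.copyLoad b * I.scaledCapacity b * I.scaledDemand b v := Nat.mul_le_mul_right _ h₂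
    _ = _ := by ring

/-- The number of units that the `p`-th copy of `v` stands for; the last copies of `v` may stand
for less than `copyLoad` units. -/
def copyAmount (v : Fin I.n) (p : ℕ) : ℕ := min (I.copyLoad b) (I.q v - p * I.copyLoad b)

lemma sum_copyAmount (v : Fin I.n) :
    ∑ p : Fin (I.scaledDemand b v), I.copyAmount b v p = I.q v := by
  rw [Fin.sum_univ_eq_sum_range fun p => I.copyAmount b v p]
  exact (sum_min_tsub _ _ _).trans (min_eq_right (I.demand_le b v))

/-- The potential of a vehicle that must refill pays for the trip to the depot and back. Normally
`load < copyLoad` forces the load to be at most Q/2. -/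
lemma refill_le (hb : 1 ≤ b) {load : ℕ} (h : load < I.copyLoad b) (u : Fin I.n) :
    2 * I.d I.depot u ≤ 4 * ((I.Q - load) / I.Q) * I.d I.depot u := by
  have h₁ := I.copyLoad_mul_lt b
  have h₂ := I.scaledCapacity_pos b
  have h₀ : (0 : ℚ) < I.Q := by exact_mod_cast I.Q_pos
  by_cases hl : 2 * load ≤ I.Q
  · refine mul_le_mul_of_nonneg_right ?_ (I.metric.nonneg _ _)
    have : (2 * load : ℚ) ≤ I.Q := by exact_mod_cast hl
    rw [← mul_div_assoc, le_div_iff₀ h₀]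
    linarith
  · have h₃ : I.scaledCapacity b = 1 := by
      by_contra h₃
      have h₄ : 2 ≤ I.scaledCapacity b := by omega
      nlinarith
    have h₅ : I.n = 1 := by
      rcases I.scaledCapacity_eq_or_le b hb with h | h
      · rw [h₃, ← h, h₃] at h₁
        omega
      · have := I.n_pos
        omega
    have : u = I.depot := by
      apply Fin.ext
      have := u.2
      have := I.depot.2
      omega
    rw [this, I.metric.self]
    simp

end HVRP

/-! ### From tours through copies to deliveries -/

section Route

variable (I : HVRP) (m : ℕ) {α : Type} [DecidableEq α] (π : α → Fin I.n)

/-- The stops of a vehicle that carries `load` units and is about to go through the points `l`,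
where `rem x` units are still to be dropped at `x`. Before each visit it fills up at the depot if
it carries less than `m` units. -/
def route : (α → ℕ) → ℕ → List α → List (Stop I.n)
  | _, _, [] => []
  | rem, load, x :: l =>
    (if load < m then ⟨I.depot, I.Q - load, 0⟩ else ⟨π x, 0, 0⟩) :: ⟨π x, 0, rem x⟩ ::
      route (Function.update rem x 0) ((if load < m then I.Q else load) - rem x) l

variable {I m}

lemma update_zero_le {rem : α → ℕ} (h : ∀ x, rem x ≤ m) (x y : α) :
    Function.update rem x 0 y ≤ m := by
  rcases eq_or_ne y x with rfl | hy
  · simp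
  · simpa [hy] using h y

/-- The idle stop inserted when no refill is needed makes the number of stops independent of the
refills, so a program can write it before simulating the tour. -/
lemma length_route (l : List α) (rem : α → ℕ) (load : ℕ) :
    (route I m π rem load l).length = 2 * l.length := by
  induction l generalizing rem load with
  | nil => rfl
  | cons x l ih => simp only [route, List.length_cons, ih]; ring

lemma carries_route (hm : m ≤ I.Q) (l : List α) {rem : α → ℕ} (hrem : ∀ x, rem x ≤ m) {load : ℕ}
    (hload : load ≤ I.Q) : I.Carries load (route I m π rem load l) := by
  induction l generalizing rem load with
  | nil => trivial
  | cons x l ih =>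
    have h := hrem x
    have ih' := fun {load'} => ih (update_zero_le hrem x) (load := load')
    unfold route
    split_ifs with hl
    · refine ⟨fun _ => rfl, by simp only; omega, by simp only; omega, ?_⟩
      simp only [show load + (I.Q - load) - 0 = I.Q by omega]
      exact ⟨by simp, by simp, by simp only; omega, ih' (by simp)⟩
    · refine ⟨by simp, by simpa, by simp, ?_⟩
      exact ⟨by simp, by simpa, by simp only; omega, ih' (by simp only; omega)⟩

lemma delivered_cons {n : ℕ} (v : Fin n) (s : Stop n) (l : List (Stop n)) :
    delivered v (s :: l) = (if s.vertex = v then s.drop else 0) + delivered v l := by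
  unfold delivered
  rw [List.filter_cons]
  split_ifs <;> simp_all

/-- The first visit sets the remaining amount to 0, so a point counts once however often `l` passes
through it. -/
lemma delivered_route [Fintype α] (v : Fin I.n) (l : List α) (rem : α → ℕ) (load : ℕ) :
    delivered v (route I m π rem load l) =
      ∑ y, if π y = v ∧ y ∈ l then rem y else 0 := by
  induction l generalizing rem load with
  | nil => simp [route, delivered]
  | cons x l ih =>
    rw [route, delivered_cons, delivered_cons, ih, ← Finset.sum_erase_add _ _ (Finset.mem_univ x),
      ← Finset.sum_erase_add (a := x) _ _ (Finset.mem_univ x)]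
    have h : ∀ y ∈ Finset.univ.erase x,
        (if π y = v ∧ y ∈ l then Function.update rem x 0 y else 0) =
          if π y = v ∧ y ∈ x :: l then rem y else 0 := fun y hy => by
      simp [Finset.ne_of_mem_erase hy]
    rw [Finset.sum_congr rfl h]
    simp only [Function.update_self, List.mem_cons_self, and_true]
    split_ifs <;> simp_all [add_comm]

/-- Amortized analysis: the last summand is the potential of the current load and position.
`hrefill` lets it pay for a refill; `hδm` lets 8 times the new distance pay for the move (5 = 1 for
the distance + 4 for the potential) and for the drop. The hypothesis `rem x = 0` says that the
current point has already been served. -/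
lemma pathLength_route_le (hm : m ≤ I.Q)
    (hrefill : ∀ load < m, ∀ u, 2 * I.d I.depot u ≤
      4 * ((I.Q - load) / I.Q) * I.d I.depot u)
    {δ : α → α → ℚ} (hδ : ∀ x y, 5 * I.d (π x) (π y) ≤ 8 * δ x y)
    (hδm : ∀ x y, x ≠ y →
      5 * I.d (π x) (π y) + 4 * (m / I.Q) * I.d I.depot (π y) ≤ 8 * δ x y)
    {z : α} (hz : π z = I.depot) (l : List α) {rem : α → ℕ} (hrem : ∀ x, rem x ≤ m) {load : ℕ}
    (hload : load ≤ I.Q) {x : α} (hx : rem x = 0) :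
    pathLength I.d (π x :: (route I m π rem load l).map Stop.vertex ++ [I.depot]) ≤
      8 * pathLength δ (x :: l ++ [z]) + 4 * ((I.Q - load) / I.Q) * I.d I.depot (π x) := by
  have hQ : (0 : ℚ) < I.Q := by exact_mod_cast I.Q_pos
  have key : ∀ load : ℕ, load ≤ I.Q → ∀ u, 0 ≤ 4 * ((I.Q - load) / I.Q) * I.d I.depot u :=
    fun load h u => by
      have h₁ : (0 : ℚ) ≤ I.Q - load := sub_nonneg.2 (by exact_mod_cast h)
      have := I.metric.nonneg I.depot u
      positivity
  induction l generalizing rem load x with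
  | nil =>
    have h₁ := hδ x z
    have h₂ := I.metric.nonneg (π x) I.depot
    have h₃ := key load hload (π x)
    rw [hz] at h₁
    simp only [route, List.map_nil, List.cons_append, List.nil_append, pathLength]
    linarith
  | cons y l ih =>
    have hstep : 5 * I.d (π x) (π y) + 4 * (rem y / I.Q) * I.d I.depot (π y) ≤ 8 * δ x y := by
      rcases eq_or_ne x y with rfl | hxy
      -- Staying at a point contributes no pendant length, but nothing is left to drop there either.
      · simpa [hx] using hδ x x
      · refine le_trans ?_ (hδm x y hxy)
        have h₁ : (rem y : ℚ) ≤ m := by exact_mod_cast hrem y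
        have := I.metric.nonneg I.depot (π y)
        gcongr
    have hy := hrem y
    have ih' := fun {load'} (h : load' ≤ I.Q) =>
      ih (update_zero_le hrem y) h (Function.update_self y 0 rem)
    simp only [List.cons_append, route, List.map_cons, pathLength_cons_cons] at ih' ⊢
    split_ifs with hl
    -- Refill: the detour through the depot costs at most 2·d(r,x) + d(x,y). The old potential pays
    -- the first term, and the new potential comes only from the drop at y.
    · have h₁ := ih' (load' := I.Q - rem y) (by omega)
      have h₂ := hrefill load hl (π x)
      have h₃ := I.metric.triangle I.depot (π x) (π y)
      have h₄ := I.metric.symm (π x) I.depot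
      have h₅ := I.metric.nonneg (π x) (π y)
      rw [Nat.cast_sub (hy.trans hm), sub_sub_cancel] at h₁
      linarith
    -- No refill: since (Q - load)/Q ≤ 1, moving to y raises the potential by at most 4·d(x,y), and
    -- the drop adds 4·(rem y/Q)·d(r,y).
    · have h₁ := ih' (load' := load - rem y) (by omega)
      have h₃ := I.metric.triangle I.depot (π x) (π y)
      have h₅ := I.metric.nonneg (π x) (π y)
      have h₆ : (0 : ℚ) ≤ 4 * ((I.Q - load) / I.Q) := by
        have : (load : ℚ) ≤ I.Q := by exact_mod_cast hload
        have : (0 : ℚ) ≤ I.Q - load := by linarith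
        positivity
      have h₇ : 4 * (((I.Q : ℚ) - load) / I.Q) ≤ 4 := by
        have : ((I.Q : ℚ) - load) / I.Q ≤ 1 :=
          (div_le_one hQ).2 (by linarith [(Nat.cast_nonneg load : (0 : ℚ) ≤ load)])
        linarith
      have h₈ : 4 * (((I.Q : ℚ) - ((load - rem y : ℕ) : ℚ)) / I.Q) =
          4 * ((I.Q - load) / I.Q) + 4 * (rem y / I.Q) := by
        rw [Nat.cast_sub (by omega)]
        ring
      have h₉ := mul_le_mul_of_nonneg_left h₃ h₆
      have h₁₀ := mul_le_mul_of_nonneg_right h₇ h₅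
      rw [h₈] at h₁
      rw [I.metric.self]
      linarith

end Route

/-! ### The solution obtained from a tour through the copies -/

namespace HVRP

variable (I : HVRP) (b : ℕ)

/-- The reduced instance for the scaled demands. -/
abbrev reduced : HTSP := copyInstance I (I.scaledDemand b) (I.scaledCapacity b)

/-- The original vertex of a point of `I.reduced b`. -/
abbrev reducedVertex : Fin (I.reduced b).n → Fin I.n :=
  pointVertex I (I.scaledDemand b) (I.scaledCapacity b)

/-- The number of units that a point of `I.reduced b` stands for. -/
def reducedAmount (i : Fin (I.reduced b).n) : ℕ :=
  match pointEquiv I (I.scaledDemand b) (I.scaledCapacity b) i with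
  | none => 0
  | some ⟨v, p⟩ => I.copyAmount b v p

lemma reducedAmount_le (i : Fin (I.reduced b).n) : I.reducedAmount b i ≤ I.copyLoad b := by
  unfold reducedAmount
  split
  · exact Nat.zero_le _
  · exact min_le_left _ _

lemma reducedAmount_depot : I.reducedAmount b (I.reduced b).depot = 0 := rfl

lemma sum_reducedAmount (v : Fin I.n) :
    ∑ i, (if I.reducedVertex b i = v then I.reducedAmount b i else 0) = I.q v := by
  rw [← Equiv.sum_comp (pointEquiv I (I.scaledDemand b) (I.scaledCapacity b)).symm]
  have h₁ : ∀ u p, I.reducedVertex b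
      ((pointEquiv I (I.scaledDemand b) (I.scaledCapacity b)).symm (some ⟨u, p⟩)) = u :=
    fun u p => pointVertex_copyIndex ..
  have h₂ : ∀ u p, I.reducedAmount b
      ((pointEquiv I (I.scaledDemand b) (I.scaledCapacity b)).symm (some ⟨u, p⟩)) =
        I.copyAmount b u p := fun u p => by simp [reducedAmount]
  have h₃ : I.reducedAmount b
      ((pointEquiv I (I.scaledDemand b) (I.scaledCapacity b)).symm none) = 0 := by
    simp [reducedAmount]
  have h₄ : ∀ u, (∑ p : Fin (I.scaledDemand b u), if u = v then I.copyAmount b u p else 0) =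
      if u = v then I.q u else 0 := fun u => by split_ifs <;> simp [sum_copyAmount]
  simp only [Fintype.sum_option, Fintype.sum_sigma, h₁, h₂, h₃, h₄, ite_self, zero_add]
  simp

variable {I b}

open Classical in
/-- What is still to be dropped at each point when vehicle `i` starts and the vehicles with smaller
numbers have finished. -/
noncomputable def remaining (τ : (I.reduced b).Solution) (i : ℕ) (y : Fin (I.reduced b).n) : ℕ :=
  if ∃ j : Fin I.k, (j : ℕ) < i ∧ y ∈ τ j then 0 else I.reducedAmount b y

/-- The solution obtained from tours through the copies. -/
noncomputable def expand (τ : (I.reduced b).Solution) : I.Solution := fun i =>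
  route I (I.copyLoad b) (I.reducedVertex b) (remaining τ i) 0 (τ i)

lemma remaining_le (τ : (I.reduced b).Solution) (i : ℕ) (y : Fin (I.reduced b).n) :
    remaining τ i y ≤ I.reducedAmount b y := by
  unfold remaining
  split_ifs
  · exact Nat.zero_le _
  · exact le_rfl

lemma feasible_expand {τ : (I.reduced b).Solution} (hτ : (I.reduced b).Feasible τ) :
    I.Feasible (expand τ) := by
  refine ⟨fun i => carries_route _ (I.copyLoad_le b) _
    (fun y => (remaining_le τ i y).trans (I.reducedAmount_le b y)) (Nat.zero_le _), fun v => ?_⟩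
  simp only [expand, delivered_route]
  rw [Finset.sum_comm, ← I.sum_reducedAmount b v]
  refine Finset.sum_congr rfl fun y _ => ?_
  by_cases hv : I.reducedVertex b y = v
  swap
  · simp [hv]
  simp only [hv, true_and, if_true]
  by_cases hy : ∃ j : Fin I.k, y ∈ τ j
  · classical
    -- The vehicle of smallest index that visits y serves it; all later ones find nothing remaining.
    obtain ⟨i, hi, hmin⟩ : ∃ i : Fin I.k, y ∈ τ i ∧ ∀ j : Fin I.k, j < i → y ∉ τ j := by
      obtain ⟨i, hi, hmin⟩ := WellFounded.has_min (wellFounded_lt (α := Fin I.k))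
        {j | y ∈ τ j} hy
      exact ⟨i, hi, fun j hj hj' => hmin j hj' hj⟩
    rw [Finset.sum_eq_single_of_mem i (Finset.mem_univ i)]
    · rw [if_pos hi, remaining, if_neg]
      rintro ⟨j, hj, hj'⟩
      exact hmin j hj hj'
    · intro j _ hj
      by_cases hyj : y ∈ τ j
      · rw [if_pos hyj, remaining, if_pos]
        refine ⟨i, lt_of_le_of_ne ?_ (fun h => hj (Fin.ext h.symm)), hi⟩
        exact not_lt.1 fun h => hmin j h hyj
      · rw [if_neg hyj]
  -- A point in no list can only be the depot, which every closed tour contains automatically and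
  -- which stands for no units.
  · have h₁ : y = (I.reduced b).depot := by
      obtain ⟨i, hi⟩ := hτ y
      by_contra h
      refine hy ⟨i, ?_⟩
      simpa [closeTour, h] using hi
    rw [h₁] at hy ⊢
    rw [reducedAmount_depot]
    refine Finset.sum_eq_zero fun j _ => if_neg fun h => hy ⟨j, h⟩

/-- The factor is 8 because a copy's load is at most 2Q/Q', where Q' is the scaled capacity, so the
term 4·(m/Q)·d(r,y) is at most 8 pendant lengths. The initial potential is 0 since every tour starts
at the depot. -/
lemma makespan_expand_le (hb : 1 ≤ b) (τ : (I.reduced b).Solution) :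
    I.makespan (expand τ) ≤ 8 * (I.reduced b).makespan τ := by
  refine maxCompletion_le I.k_pos I.speed_pos (by norm_num) fun i => ?_
  set π := I.reducedVertex b with hπ
  have hQ : (0 : ℚ) < I.Q := by exact_mod_cast I.Q_pos
  have hQ' : (0 : ℚ) < I.scaledCapacity b := by exact_mod_cast I.scaledCapacity_pos b
  have hm : (I.copyLoad b : ℚ) / I.Q ≤ 2 / I.scaledCapacity b := by
    rw [div_le_div_iff₀ hQ hQ']
    have h₁ := I.copyLoad_mul_lt b
    have h₂ := I.scaledCapacity_le b
    have h₃ : I.copyLoad b * I.scaledCapacity b ≤ 2 * I.Q := by omega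
    exact_mod_cast h₃
  have hstep : ∀ x y, x ≠ y → 5 * I.d (π x) (π y) +
      4 * (I.copyLoad b / I.Q) * I.d I.depot (π y) ≤ 8 * (I.reduced b).d x y := fun x y hxy => by
    have h₁ := pointPendant_nonneg I (I.scaledDemand b) (I.scaledCapacity b) x
    have h₂ := mul_le_mul_of_nonneg_right hm (I.metric.nonneg I.depot (π y))
    have h₃ : 2 / I.scaledCapacity b * I.d I.depot (π y) =
        2 * pointPendant I (I.scaledDemand b) (I.scaledCapacity b) y := by
      unfold pointPendant
      ring
    have h₄ := I.metric.nonneg (π x) (π y)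
    rw [copyInstance_d, if_neg hxy]
    linarith
  have h := pathLength_route_le π (I.copyLoad_le b) (fun load hl u => I.refill_le b hb hl u)
    (δ := (I.reduced b).d) (fun x y => ?_) hstep (z := (I.reduced b).depot) rfl (τ i)
    (fun y => (remaining_le τ i y).trans (I.reducedAmount_le b y)) (Nat.zero_le I.Q)
    (x := (I.reduced b).depot)
    (Nat.le_zero.1 ((remaining_le τ i _).trans (I.reducedAmount_depot b).le))
  · refine h.trans (le_of_eq ?_)
    rw [hπ, reducedVertex, pointVertex_depot, I.metric.self, mul_zero, add_zero]
    rfl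
  · rcases eq_or_ne x y with rfl | hxy
    · simp [I.metric.self, (I.reduced b).metric.self]
    · refine le_trans (le_add_of_nonneg_right ?_) (hstep x y hxy)
      have := I.metric.nonneg I.depot (π y)
      positivity

end HVRP

/-! ### From deliveries to tours through the copies -/

/-- Every unit dropped at `v` has been carried over the distance from the depot to `v`. -/
lemma HVRP.sum_drop_le (I : HVRP) (l : List (Stop I.n)) {load : ℕ} (hl : I.Carries load l)
    (hload : load ≤ I.Q) (u : Fin I.n) :
    (l.map fun s => (s.drop : ℚ) * I.d I.depot s.vertex).sum ≤ load * I.d I.depot u +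
      I.Q * pathLength I.d (u :: l.map Stop.vertex ++ [I.depot]) := by
  induction l generalizing load u with
  | nil =>
    have h₁ := I.metric.nonneg I.depot u
    have h₂ := I.metric.pathLength_nonneg [u, I.depot]
    simp only [List.map_nil, List.sum_nil, List.cons_append, List.nil_append]
    positivity
  | cons s l ih =>
    obtain ⟨hpick, hcap, hdrop, hl⟩ := hl
    have h₁ := ih hl ((Nat.sub_le _ _).trans hcap) s.vertex
    -- The potential load·d(r, position) grows by at most Q times the distance moved. Picking up
    -- leaves it at 0, because that happens only at the depot.
    have h₂ : ((load + s.pick : ℕ) : ℚ) * I.d I.depot s.vertex ≤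
        load * I.d I.depot u + I.Q * I.d u s.vertex := by
      have h₃ := I.metric.nonneg u s.vertex
      have h₅ := I.metric.nonneg I.depot u
      by_cases hp : s.pick = 0
      · have h₄ : (load : ℚ) ≤ I.Q := by exact_mod_cast hload
        have h₆ := mul_le_mul_of_nonneg_left (I.metric.triangle I.depot u s.vertex)
          (Nat.cast_nonneg (α := ℚ) load)
        have h₇ := mul_le_mul_of_nonneg_right h₄ h₃
        rw [hp, add_zero]
        linarith
      · rw [hpick hp, I.metric.self, mul_zero]
        rw [hpick hp] at h₃
        positivity
    rw [Nat.cast_sub hdrop] at h₁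
    simp only [List.map_cons, List.sum_cons, List.cons_append, pathLength_cons_cons] at h₁ ⊢
    linarith

lemma sum_drop_eq {n : ℕ} (f : Fin n → ℚ) (l : List (Stop n)) :
    (l.map fun s => (s.drop : ℚ) * f s.vertex).sum = ∑ v, (delivered v l : ℚ) * f v := by
  induction l with
  | nil => simp [delivered]
  | cons s l ih =>
    rw [List.map_cons, List.sum_cons, ih]
    simp [delivered_cons, add_mul, Finset.sum_add_distrib]

lemma mem_map_vertex_of_delivered {n : ℕ} {v : Fin n} {l : List (Stop n)}
    (h : delivered v l ≠ 0) : v ∈ l.map Stop.vertex := by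
  by_contra hv
  refine h ?_
  rw [delivered, List.filter_eq_nil_iff.2]
  · rfl
  · intro s hs hsv
    exact hv (List.mem_map.2 ⟨s, hs, by simpa using hsv⟩)

/-- Embed the N items into a disjoint union of blocks of sizes `f i`, and assign each item to the
block it lands in. -/
lemma exists_fun_card_fiber_le {k N : ℕ} (f : Fin k → ℕ) (h : N ≤ ∑ i, f i) :
    ∃ g : Fin N → Fin k, ∀ i, ((List.finRange N).filter fun p => g p = i).length ≤ f i := by
  obtain ⟨e⟩ : Nonempty (Fin N ↪ Σ i, Fin (f i)) :=
    Function.Embedding.nonempty_of_card_le (by simpa using h)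
  refine ⟨fun p => (e p).1, fun i => ?_⟩
  set L := (List.finRange N).filter fun p => (e p).1 = i with hL
  have hnd : L.Nodup := (List.nodup_finRange N).filter _
  have h₁ : L.toFinset.map e ⊆ (Finset.univ : Finset (Fin (f i))).map
      ⟨Sigma.mk i, sigma_mk_injective⟩ := fun x hx => by
    obtain ⟨p, hp, rfl⟩ := Finset.mem_map.1 hx
    have hp : (e p).1 = i := by simpa [hL] using hp
    subst hp
    exact Finset.mem_map.2 ⟨(e p).2, Finset.mem_univ _, rfl⟩
  have h₂ := Finset.card_le_card h₁
  rwa [Finset.card_map, Finset.card_map, Finset.card_univ, Fintype.card_fin,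
    List.toFinset_card_of_nodup hnd] at h₂

namespace HVRP

variable {I : HVRP} {b : ℕ}

/-- The share of the copies of a vertex that goes to a vehicle dropping `x` units there. -/
def share (I : HVRP) (b x : ℕ) : ℕ := (x * I.scaledCapacity b + I.Q - 1) / I.Q

/-- Subadditivity of rounding up, applied to the amounts the vehicles drop at v, whose sum is the
demand. -/
lemma scaledDemand_le_sum_share {σ : I.Solution} (hσ : I.Feasible σ) (v : Fin I.n) :
    I.scaledDemand b v ≤ ∑ i, I.share b (delivered v (σ i)) := by
  rw [scaledDemand_eq, ← Nat.ceilDiv_eq_add_pred_div, ceilDiv_le_iff_le_mul I.Q_pos, ← hσ.2 v,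
    Finset.sum_mul, Finset.mul_sum]
  refine Finset.sum_le_sum fun i _ => ?_
  rw [share, ← Nat.ceilDiv_eq_add_pred_div]
  exact (ceilDiv_le_iff_le_mul I.Q_pos).1 le_rfl

lemma share_zero : I.share b 0 = 0 := by
  have := I.Q_pos
  exact Nat.div_eq_of_lt (by omega)

/-- `ε` is the rounding loss per vertex: 0 without scaling, otherwise 1. The bound on `ε * I.n`
makes the total loss over all vertices at most one tour length. -/
lemma exists_rounding (I : HVRP) (hb : 1 ≤ b) : ∃ ε : ℚ, 0 ≤ ε ∧ ε * I.n ≤ I.scaledCapacity b ∧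
    ∀ x, (I.share b x : ℚ) ≤ x * I.scaledCapacity b / I.Q + ε := by
  have hQ : (0 : ℚ) < I.Q := by exact_mod_cast I.Q_pos
  rcases I.scaledCapacity_eq_or_le b hb with h | h
  · refine ⟨0, le_rfl, by simp, fun x => ?_⟩
    rw [share, h, ← ceil_div_eq_ceilDiv _ I.Q_pos, Nat.cast_mul,
      mul_div_cancel_right₀ _ hQ.ne', Nat.ceil_natCast, add_zero]
  · refine ⟨1, zero_le_one, by simpa using h, fun x => ?_⟩
    rw [share, ← ceil_div_eq_ceilDiv _ I.Q_pos]
    have := (Nat.ceil_lt_add_one (a := ((x * I.scaledCapacity b : ℕ) : ℚ) / I.Q)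
      (by positivity)).le
    push_cast at this ⊢
    exact this

lemma exists_reduced_solution (hb : 1 ≤ b) {σ : I.Solution} (hσ : I.Feasible σ) :
    ∃ τ, (I.reduced b).Feasible τ ∧ (I.reduced b).makespan τ ≤ 5 * I.makespan σ := by
  choose g hg using fun v => exists_fun_card_fiber_le _ (scaledDemand_le_sum_share (b := b) hσ v)
  set f : Fin I.k → Fin I.n → List (Fin (I.reduced b).n) := fun i v =>
    ((List.finRange (I.scaledDemand b v)).filter fun p => g v p = i).map
      (copyIndex I _ (I.scaledCapacity b) v) with hf
  -- Deduplication ensures that a vehicle pays for each of its copies once, even if it stops at the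
  -- vertex several times; skipping the other visits only shortens the walk.
  refine ⟨fun i => ((σ i).map Stop.vertex).dedup.flatMap (f i), fun x => ?_, ?_⟩
  · rcases eq_depot_or_copyIndex I _ _ x with rfl | ⟨v, p, rfl⟩
    · exact ⟨⟨0, I.k_pos⟩, by simp [closeTour]⟩
    · refine ⟨g v p, ?_⟩
      have h₁ : 0 < ((List.finRange (I.scaledDemand b v)).filter
          fun p' => g v p' = g v p).length :=
        List.length_pos_of_mem (List.mem_filter.2 ⟨List.mem_finRange p, by simp⟩)
      -- A vehicle dropping nothing at v has share 0, so the vehicle responsible for a copy does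
      -- stop at v.
      have h₂ : delivered v (σ (g v p)) ≠ 0 := fun h => by
        have := h₁.trans_le (hg v (g v p))
        rw [h, share_zero] at this
        exact this.false
      refine List.mem_cons_of_mem _ (List.mem_append_left _ (List.mem_flatMap.2
        ⟨v, List.mem_dedup.2 (mem_map_vertex_of_delivered h₂), List.mem_map.2 ⟨p, ?_, rfl⟩⟩))
      simp
  · refine maxCompletion_le I.k_pos I.speed_pos (by norm_num) fun i => ?_
    obtain ⟨ε, hε, hεn, hround⟩ := exists_rounding I hb
    have hQ : (0 : ℚ) < I.Q := by exact_mod_cast I.Q_pos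
    have hQ' : (0 : ℚ) < I.scaledCapacity b := by exact_mod_cast I.scaledCapacity_pos b
    set l := (σ i).map Stop.vertex with hl
    set D := pathLength I.d (closeTour I.depot l) with hD
    have hD₀ : 0 ≤ D := I.metric.pathLength_nonneg _
    set a := pointPendant I (I.scaledDemand b) (I.scaledCapacity b) with ha
    have h₁ := I.metric.pathLength_flatMap_pendant_le (δ := (I.reduced b).d)
      (π := I.reducedVertex b) (a := a) (f := f i)
      (fun x y => by
        rw [copyInstance_d]
        have h₁ := pointPendant_nonneg I (I.scaledDemand b) (I.scaledCapacity b) x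
        have h₂ := pointPendant_nonneg I (I.scaledDemand b) (I.scaledCapacity b) y
        have h₃ := I.metric.nonneg (I.reducedVertex b x) (I.reducedVertex b y)
        split_ifs
        · positivity
        · exact le_rfl)
      (fun v x hx => by
        obtain ⟨p, -, rfl⟩ := List.mem_map.1 hx
        exact pointVertex_copyIndex ..)
      (I.reduced b).depot (pointPendant_depot ..) l.dedup
    have h₂ := I.metric.pathLength_sublist I.depot (List.dedup_sublist l) I.depot
    have h₃ : ∀ v ∈ l.dedup, ((f i v).map a).sum ≤
        delivered v (σ i) * I.d I.depot v / I.Q + ε * D / I.scaledCapacity b := fun v hv => by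
      have h₄ : (f i v).map a = List.replicate (f i v).length
          (I.d I.depot v / I.scaledCapacity b) := by
        refine List.eq_replicate_iff.2 ⟨by simp, fun y hy => ?_⟩
        obtain ⟨x, hx, rfl⟩ := List.mem_map.1 hy
        obtain ⟨p, -, rfl⟩ := List.mem_map.1 hx
        rw [ha, pointPendant, pointVertex_copyIndex]
      have h₅ : ((f i v).length : ℚ) ≤ I.share b (delivered v (σ i)) := by
        rw [hf, List.length_map]
        exact_mod_cast hg v i
      have h₆ := I.metric.nonneg I.depot v
      have h₇ : I.d I.depot v ≤ D :=
        I.metric.dist_le_pathLength I.depot (List.mem_dedup.1 hv) I.depot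
      rw [h₄, List.sum_replicate, nsmul_eq_mul]
      calc ((f i v).length : ℚ) * (I.d I.depot v / I.scaledCapacity b)
          ≤ (delivered v (σ i) * I.scaledCapacity b / I.Q + ε) *
            (I.d I.depot v / I.scaledCapacity b) :=
            mul_le_mul_of_nonneg_right (h₅.trans (hround _)) (by positivity)
        _ = delivered v (σ i) * I.d I.depot v / I.Q +
            ε * I.d I.depot v / I.scaledCapacity b := by field_simp
        _ ≤ _ := by gcongr
    have h₄ : (l.dedup.map fun v => ((f i v).map a).sum).sum ≤ 2 * D := by
      refine (List.sum_le_sum h₃).trans ?_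
      rw [← List.sum_toFinset _ (List.nodup_dedup l), Finset.sum_add_distrib, two_mul]
      refine add_le_add ?_ ?_
      · have h₅ := I.sum_drop_le (σ i) (hσ.1 i) (Nat.zero_le _) I.depot
        rw [sum_drop_eq, I.metric.self, mul_zero, zero_add] at h₅
        calc _ ≤ ∑ v, (delivered v (σ i) : ℚ) * I.d I.depot v / I.Q :=
              Finset.sum_le_sum_of_subset_of_nonneg (Finset.subset_univ _) fun v _ _ => by
                have := I.metric.nonneg I.depot v
                positivity
          _ ≤ D := by
              rw [← Finset.sum_div, div_le_iff₀' hQ]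
              exact h₅
      · have h₅ : (l.dedup.toFinset.card : ℚ) ≤ I.n := by
          exact_mod_cast (Finset.card_le_univ _).trans (Fintype.card_fin _).le
        rw [Finset.sum_const, nsmul_eq_mul, ← mul_div_assoc, div_le_iff₀ hQ']
        nlinarith [mul_le_mul_of_nonneg_right h₅ (mul_nonneg hε hD₀),
          mul_le_mul_of_nonneg_right hεn hD₀]
    refine h₁.trans ?_
    simp only [reducedVertex, pointVertex_depot] at h₂ ⊢
    have h₅ : pathLength I.d (I.depot :: l ++ [I.depot]) = D := rfl
    linarith

/-- The factor 5 is weakened to 8, so that one constant serves both directions. -/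
lemma opt_reduced_le (I : HVRP) (hb : 1 ≤ b) : (I.reduced b).opt ≤ (8 : ℕ) * I.opt := by
  rw [opt, ENNReal.mul_iInf_of_ne (by simp) (by simp)]
  refine le_iInf fun σ => ?_
  rw [ENNReal.mul_iInf_of_ne (by simp) (by simp)]
  refine le_iInf fun hσ => ?_
  obtain ⟨τ, hτ, hle⟩ := exists_reduced_solution hb hσ
  refine (iInf₂_le τ hτ).trans ?_
  have h₀ : 0 ≤ I.makespan σ := (div_nonneg (I.metric.pathLength_nonneg _)
    (I.speed_pos ⟨0, I.k_pos⟩).le).trans (Finset.le_sup'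
      (fun i => pathLength I.d (closeTour I.depot ((σ i).map Stop.vertex)) / I.speed i)
      (Finset.mem_univ ⟨0, I.k_pos⟩))
  have h : ((I.reduced b).makespan τ : ℝ) ≤ (8 : ℕ) * (I.makespan σ : ℝ) := by
    have : (I.reduced b).makespan τ ≤ 8 * I.makespan σ := by linarith
    exact_mod_cast this
  refine (ENNReal.ofReal_le_ofReal h).trans (le_of_eq ?_)
  rw [ENNReal.ofReal_mul (by positivity), ENNReal.ofReal_natCast]

end HVRP

/-! ### Cost of programs whose registers and memory stay small -/

/-- All registers and memory cells hold numbers of at most `S` bits. -/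
structure Store.Fits (S : ℕ) (s : Store) : Prop where
  reg_lt : ∀ i, s.reg i < 2 ^ S
  mem_lt : ∀ a, s.mem a < 2 ^ S

/-- On stores with numbers of at most `S` bits, the value has at most `bits * (S + 1)` bits. -/
def Expr.bits : Expr → ℕ
  | .const c => c.size
  | .reg _ => 1
  | .load _ => 1
  | .add x y => x.bits + y.bits + 1
  | .sub x _ => x.bits
  | .mul x y => x.bits + y.bits
  | .div x _ => x.bits
  | .lt _ _ => 1

/-- On stores with numbers of at most `S` bits, evaluation costs at most `units * (S + 1)`. -/
def Expr.units : Expr → ℕ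
  | .const c => 1 + c.size
  | .reg _ => 2
  | .load a => a.units + 2
  | .add x y => x.units + y.units + (1 + (x.bits + y.bits + 1))
  | .sub x y => x.units + y.units + (1 + x.bits)
  | .mul x y => x.units + y.units + (1 + (x.bits + y.bits))
  | .div x y => x.units + y.units + (1 + x.bits)
  | .lt x y => x.units + y.units + 2

/-- Intermediate values may exceed S bits, but only by a factor depending on the expression. Hence
only values written back to registers or memory need an individual bound. -/
lemma Store.Fits.eval_lt {S : ℕ} {s : Store} (h : s.Fits S) :
    ∀ x : Expr, x.eval s < 2 ^ (x.bits * (S + 1))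
  | .const c => (Nat.lt_size_self c).trans_le
      (Nat.pow_le_pow_right two_pos (Nat.le_mul_of_pos_right _ S.succ_pos))
  | .reg i => (h.reg_lt i).trans_le (Nat.pow_le_pow_right two_pos (by simp [Expr.bits]))
  | .load a => (h.mem_lt _).trans_le (Nat.pow_le_pow_right two_pos (by simp [Expr.bits]))
  | .add x y => by
    have hx : 2 ^ (x.bits * (S + 1)) ≤ 2 ^ ((x.bits + y.bits) * (S + 1)) :=
      Nat.pow_le_pow_right two_pos (Nat.mul_le_mul_right _ (Nat.le_add_right _ _))
    have hy : 2 ^ (y.bits * (S + 1)) ≤ 2 ^ ((x.bits + y.bits) * (S + 1)) :=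
      Nat.pow_le_pow_right two_pos (Nat.mul_le_mul_right _ (Nat.le_add_left _ _))
    -- The extra unit in `bits` of a sum leaves room for the carry.
    have h₁ : 2 ^ ((x.bits + y.bits) * (S + 1) + 1) ≤ 2 ^ ((x.bits + y.bits + 1) * (S + 1)) :=
      Nat.pow_le_pow_right two_pos (by rw [Nat.add_mul _ 1]; omega)
    have := h.eval_lt x
    have := h.eval_lt y
    rw [pow_succ] at h₁
    simp only [Expr.eval, Expr.bits]
    omega
  | .sub x y => (Nat.sub_le _ _).trans_lt (h.eval_lt x)
  | .mul x y => by
    simp only [Expr.eval, Expr.bits, Nat.add_mul, pow_add]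
    exact Nat.mul_lt_mul'' (h.eval_lt x) (h.eval_lt y)
  | .div x y => (Nat.div_le_self _ _).trans_lt (h.eval_lt x)
  | .lt x y => by
    have : 2 ^ 1 ≤ 2 ^ (1 * (S + 1)) := Nat.pow_le_pow_right two_pos (by omega)
    simp only [Expr.eval, Expr.bits]
    split_ifs <;> omega

lemma Store.Fits.cost_le {S : ℕ} {s : Store} (h : s.Fits S) :
    ∀ x : Expr, x.cost s ≤ x.units * (S + 1)
  | .const c => Nat.le_mul_of_pos_right _ S.succ_pos
  | .reg i => by
    have := Nat.size_le.2 (h.reg_lt i)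
    simp only [Expr.cost, Expr.units]
    omega
  | .load a => by
    have := Nat.size_le.2 (h.mem_lt (a.eval s))
    have := h.cost_le a
    simp only [Expr.cost, Expr.units, Nat.add_mul _ _ (S + 1)]
    omega
  | .add x y => by
    have := Nat.size_le.2 (h.eval_lt (.add x y))
    have := h.cost_le x
    have := h.cost_le y
    simp only [Expr.cost, Expr.units, Expr.eval, Expr.bits, Nat.add_mul _ _ (S + 1)] at *
    omega
  | .sub x y => by
    have := Nat.size_le.2 (h.eval_lt (.sub x y))
    have := h.cost_le x
    have := h.cost_le y
    simp only [Expr.cost, Expr.units, Expr.eval, Expr.bits, Nat.add_mul _ _ (S + 1)] at *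
    omega
  | .mul x y => by
    have := Nat.size_le.2 (h.eval_lt (.mul x y))
    have := h.cost_le x
    have := h.cost_le y
    simp only [Expr.cost, Expr.units, Expr.eval, Expr.bits, Nat.add_mul _ _ (S + 1)] at *
    omega
  | .div x y => by
    have := Nat.size_le.2 (h.eval_lt (.div x y))
    have := h.cost_le x
    have := h.cost_le y
    simp only [Expr.cost, Expr.units, Expr.eval, Expr.bits, Nat.add_mul _ _ (S + 1)] at *
    omega
  | .lt x y => by
    have := h.cost_le x
    have := h.cost_le y
    simp only [Expr.cost, Expr.units, Nat.add_mul _ _ (S + 1)] at *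
    omega

/-- Sum of the costs of all expressions in a program. -/
def Prog.weight : Prog → ℕ
  | .skip => 1
  | .assign _ x => 1 + x.units
  | .store a x => 1 + a.units + x.units
  | .write x => 1 + x.units
  | .seq c₁ c₂ => c₁.weight + c₂.weight
  | .ite x c₁ c₂ => 1 + x.units + (c₁.weight + c₂.weight)
  | .loop x c => 1 + x.units + c.weight

/-- Nesting depth of the loops of a program. -/
def Prog.depth : Prog → ℕ
  | .seq c₁ c₂ => max c₁.depth c₂.depth
  | .ite _ c₁ c₂ => max c₁.depth c₂.depth
  | .loop _ c => c.depth + 1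
  | _ => 0

/-- Bound for the cost of a program on numbers of at most `S` bits if each loop performs at most
`S` iterations. -/
def Prog.costBound (c : Prog) (S : ℕ) : ℕ := c.weight * (S + 2) ^ (c.depth + 1)

/-- Started in `s`, the program `c` halts within its cost bound in a store that satisfies `Post`,
and it keeps all numbers within `S` bits. -/
def Runs (S : ℕ) (c : Prog) (s : Store) (Post : Store → Prop) : Prop :=
  s.Fits S → ∃ s' t, Exec c s s' t ∧ t ≤ c.costBound S ∧ s'.Fits S ∧ Post s'

namespace Runs

variable {S : ℕ} {s : Store} {Post : Store → Prop}

/-- Gives access to the size bounds of the current store, so that reloading a stored value needs no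
separate estimate. -/
lemma of_fits {c : Prog} (h : s.Fits S → Runs S c s Post) : Runs S c s Post := fun hs => h hs hs

lemma mono {c : Prog} {Q : Store → Prop} (h : Runs S c s Q) (hQ : ∀ s, Q s → Post s) :
    Runs S c s Post := fun hs => by
  obtain ⟨s', t, h₁, h₂, h₃, h₄⟩ := h hs
  exact ⟨s', t, h₁, h₂, h₃, hQ _ h₄⟩

lemma one_add_le_costBound {S u v w : ℕ} (h₁ : u ≤ v * (S + 1)) (h₂ : 1 + v ≤ w) :
    1 + u ≤ w * (S + 2) ^ (0 + 1) := by
  rw [zero_add, pow_one]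
  calc 1 + u ≤ (1 + v) * (S + 1) := by rw [Nat.add_mul]; omega
    _ ≤ w * (S + 2) := Nat.mul_le_mul h₂ (by omega)

lemma assign {i : ℕ} {x : Expr} (hx : x.eval s < 2 ^ S)
    (hP : Post { s with reg := Function.update s.reg i (x.eval s) }) :
    Runs S (.assign i x) s Post := fun hs => by
  refine ⟨_, _, .assign i x s, one_add_le_costBound (hs.cost_le x) le_rfl,
    ⟨fun j => ?_, hs.mem_lt⟩, hP⟩
  simp only [Function.update_apply]
  split_ifs
  · exact hx
  · exact hs.reg_lt j

lemma store {a x : Expr} (hx : x.eval s < 2 ^ S)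
    (hP : Post { s with mem := Function.update s.mem (a.eval s) (x.eval s) }) :
    Runs S (.store a x) s Post := fun hs => by
  refine ⟨_, _, .store a x s, ?_, ⟨hs.reg_lt, fun j => ?_⟩, hP⟩
  · rw [add_assoc]
    refine one_add_le_costBound (v := a.units + x.units) ?_ (add_assoc _ _ _).ge
    rw [Nat.add_mul]
    exact add_le_add (hs.cost_le a) (hs.cost_le x)
  · simp only [Function.update_apply]
    split_ifs
    · exact hx
    · exact hs.mem_lt j

/-- The output tape is never read back, so written numbers need not fit into S bits. -/
lemma write {x : Expr} (hP : Post { s with out := s.out ++ [x.eval s] }) :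
    Runs S (.write x) s Post := fun hs =>
  ⟨_, _, .write x s, one_add_le_costBound (hs.cost_le x) le_rfl, ⟨hs.reg_lt, hs.mem_lt⟩, hP⟩

lemma seq {c₁ c₂ : Prog} (h : Runs S c₁ s fun s' => Runs S c₂ s' Post) :
    Runs S (.seq c₁ c₂) s Post := fun hs => by
  obtain ⟨s₁, t₁, h₁, ht₁, hs₁, hc₂⟩ := h hs
  obtain ⟨s₂, t₂, h₂, ht₂, hs₂, hP⟩ := hc₂ hs₁
  refine ⟨s₂, t₁ + t₂, h₁.seq h₂, ?_, hs₂, hP⟩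
  have e₁ : (S + 2) ^ (c₁.depth + 1) ≤ (S + 2) ^ (max c₁.depth c₂.depth + 1) :=
    Nat.pow_le_pow_right (by omega) (by omega)
  have e₂ : (S + 2) ^ (c₂.depth + 1) ≤ (S + 2) ^ (max c₁.depth c₂.depth + 1) :=
    Nat.pow_le_pow_right (by omega) (by omega)
  simp only [Prog.costBound, Prog.weight, Prog.depth, Nat.add_mul] at *
  exact add_le_add (ht₁.trans (Nat.mul_le_mul_left _ e₁)) (ht₂.trans (Nat.mul_le_mul_left _ e₂))

lemma loop_aux {x : Expr} {c : Prog} (Inv : ℕ → Store → Prop) (K : ℕ)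
    (hstep : ∀ j < K, ∀ s, Inv j s → x.eval s ≠ 0 ∧ Runs S c s (Inv (j + 1)))
    (hdone : ∀ s, Inv K s → x.eval s = 0) (j : ℕ) (hj : j ≤ K) (s : Store) (h : Inv j s)
    (hs : s.Fits S) :
    ∃ s' t, Exec (.loop x c) s s' t ∧
      t ≤ (K + 1 - j) * ((1 + x.units) * (S + 1) + c.costBound S) ∧ s'.Fits S ∧ Inv K s' := by
  have hx : ∀ s : Store, s.Fits S → 1 + x.cost s ≤ (1 + x.units) * (S + 1) := fun s hs => by
    have := hs.cost_le x
    rw [Nat.add_mul]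
    omega
  induction hd : K - j generalizing j s with
  | zero =>
    obtain rfl : j = K := by omega
    refine ⟨s, _, .loopDone (hdone s h), ?_, hs, h⟩
    rw [Nat.add_sub_cancel_left, one_mul]
    exact (hx s hs).trans (Nat.le_add_right _ _)
  | succ d ih =>
    obtain ⟨hx₀, hc⟩ := hstep j (by omega) s h
    obtain ⟨s₁, t₁, h₁, ht₁, hs₁, hI⟩ := hc hs
    obtain ⟨s₂, t₂, h₂, ht₂, hs₂, hP⟩ := ih (j + 1) (by omega) s₁ hI hs₁ (by omega)
    refine ⟨s₂, _, .loopStep hx₀ h₁ h₂, ?_, hs₂, hP⟩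
    have := hx s hs
    rw [show K + 1 - j = (K + 1 - (j + 1)) + 1 by omega, Nat.succ_mul]
    omega

lemma loop {x : Expr} {c : Prog} (Inv : ℕ → Store → Prop) {K : ℕ} (hK : K ≤ S)
    (hstep : ∀ j < K, ∀ s, Inv j s → x.eval s ≠ 0 ∧ Runs S c s (Inv (j + 1)))
    (hdone : ∀ s, Inv K s → x.eval s = 0) (h : Inv 0 s) :
    Runs S (.loop x c) s (Inv K) := fun hs => by
  obtain ⟨s', t, h₁, ht, h₂⟩ := loop_aux Inv K hstep hdone 0 (Nat.zero_le _) s h hs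
  refine ⟨s', t, h₁, ht.trans ?_, h₂⟩
  have e₁ : S + 1 ≤ (S + 2) ^ (c.depth + 1) :=
    (by omega : S + 1 ≤ S + 2).trans (Nat.le_self_pow (by omega) _)
  -- At most S rounds involve at most S + 1 tests, the failing one included; a loop thus costs one
  -- further factor S + 2.
  calc (K + 1 - 0) * ((1 + x.units) * (S + 1) + c.costBound S)
      ≤ (S + 2) * ((1 + x.units) * (S + 2) ^ (c.depth + 1) + c.costBound S) :=
        Nat.mul_le_mul (by omega) (Nat.add_le_add_right (Nat.mul_le_mul_left _ e₁) _)
    _ = _ := by simp only [Prog.costBound, Prog.weight, Prog.depth]; ring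

end Runs

/-- Repeat `c` with register `i` running through the numbers below the content of register `r`. -/
def Prog.forLoop (i r : ℕ) (c : Prog) : Prog :=
  .seq (.assign i (.const 0))
    (.loop (.lt (.reg i) (.reg r)) (.seq c (.assign i (.add (.reg i) (.const 1)))))

/-- The invariant must fix the counter and the bound, and the body must restore the counter; this
gives exactly K rounds. -/
lemma Runs.forLoop {S : ℕ} {s : Store} {i r : ℕ} {c : Prog} (Inv : ℕ → Store → Prop) {K : ℕ}
    (hK : K ≤ S) (hInv : ∀ j s, Inv j s → s.reg i = j ∧ s.reg r = K)
    (h : Inv 0 { s with reg := Function.update s.reg i 0 })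
    (hstep : ∀ j < K, ∀ s, Inv j s → Runs S c s fun s' =>
      s'.reg i = j ∧ Inv (j + 1) { s' with reg := Function.update s'.reg i (j + 1) }) :
    Runs S (.forLoop i r c) s (Inv K) := by
  refine .seq (.assign (by simp [Expr.eval]) ?_)
  refine .loop Inv hK (fun j hj s hs => ⟨?_, ?_⟩) (fun s hs => ?_) h
  · simp [Expr.eval, hInv j s hs, hj]
  · refine .seq ((hstep j hj s hs).mono fun s' hs' => .assign ?_ ?_)
    · simp only [Expr.eval, hs'.1]
      exact (Nat.succ_le_of_lt hj).trans_lt (hK.trans_lt S.lt_two_pow_self)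
    · simpa only [Expr.eval, hs'.1] using hs'.2
  · simp [Expr.eval, hInv K s hs]

/-! ### Reading the input -/

lemma getD_flatMap {α : Type} {c : ℕ} (g : α → List ℕ) (hg : ∀ x, (g x).length = c) (l : List α)
    (i j : ℕ) (hi : i < l.length) (hj : j < c) :
    (l.flatMap g).getD (c * i + j) 0 = (g l[i]).getD j 0 := by
  induction l generalizing i with
  | nil => simp at hi
  | cons x l ih =>
    rw [List.flatMap_cons]
    cases i with
    | zero =>
      rw [List.getD_append _ _ _ _ (by rw [hg]; omega)]
      simp
    | succ i =>
      rw [List.getD_append_right _ _ _ _ (by rw [hg, Nat.mul_succ]; omega), hg,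
        show c * (i + 1) + j - c = c * i + j by rw [Nat.mul_succ]; omega,
        ih i (by simpa using hi)]
      simp

lemma length_flatMap_const {α : Type} {c : ℕ} (g : α → List ℕ) (hg : ∀ x, (g x).length = c)
    (l : List α) : (l.flatMap g).length = c * l.length := by
  induction l with
  | nil => rfl
  | cons x l ih => rw [List.flatMap_cons, List.length_append, ih, hg, List.length_cons]; ring

lemma length_codeVector {k : ℕ} (f : Fin k → ℕ × ℕ) : (codeVector f).length = 2 * k := by
  rw [codeVector, length_flatMap_const (c := 2) _ (fun _ => rfl), List.length_finRange]

lemma getD_codeVector {k : ℕ} (f : Fin k → ℕ × ℕ) (i : Fin k) :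
    (codeVector f).getD (2 * i) 0 = (f i).1 ∧ (codeVector f).getD (2 * i + 1) 0 = (f i).2 := by
  have h₁ := getD_flatMap (c := 2) (fun i => [(f i).1, (f i).2]) (fun _ => rfl) (List.finRange k)
    i 0 (by simp) two_pos
  have h₂ := getD_flatMap (c := 2) (fun i => [(f i).1, (f i).2]) (fun _ => rfl) (List.finRange k)
    i 1 (by simp) one_lt_two
  simp only [List.getElem_finRange, Fin.cast_mk, add_zero] at h₁ h₂
  exact ⟨h₁, h₂⟩

lemma length_codeMatrix {n : ℕ} (f : Fin n → Fin n → ℕ × ℕ) :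
    (codeMatrix f).length = 2 * n * n := by
  rw [codeMatrix, length_flatMap_const _ (fun i => length_codeVector (f i)),
    List.length_finRange]

lemma getD_codeMatrix {n : ℕ} (f : Fin n → Fin n → ℕ × ℕ) (u v : Fin n) :
    (codeMatrix f).getD (2 * (n * u + v)) 0 = (f u v).1 ∧
      (codeMatrix f).getD (2 * (n * u + v) + 1) 0 = (f u v).2 := by
  have h := getD_flatMap (fun i => codeVector (f i)) (fun i => length_codeVector (f i))
    (List.finRange n) u
  have h₁ := h (2 * v) (by simp) (by omega)
  have h₂ := h (2 * v + 1) (by simp) (by omega)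
  simp only [List.getElem_finRange, Fin.cast_mk, (getD_codeVector _ v).1,
    (getD_codeVector _ v).2] at h₁ h₂
  rw [← h₁, ← h₂]
  exact ⟨congrArg (List.getD _ · 0) (by ring), congrArg (List.getD _ · 0) (by ring)⟩

/-- The positions of the data of the instance in the input. -/
structure Layout (I : HVRP) (D : Fin I.n → Fin I.n → ℕ × ℕ) (T : Fin I.k → ℕ × ℕ)
    (inp : List ℕ) : Prop where
  n : inp.getD 0 0 = I.n
  k : inp.getD 1 0 = I.k
  depot : inp.getD 2 0 = I.depot
  Q : inp.getD 3 0 = I.Q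
  q : ∀ v : Fin I.n, inp.getD (4 + v) 0 = I.q v
  num : ∀ u v : Fin I.n, inp.getD (4 + I.n + 2 * (I.n * u + v)) 0 = (D u v).1
  den : ∀ u v : Fin I.n, inp.getD (4 + I.n + 2 * (I.n * u + v) + 1) 0 = (D u v).2
  speedNum : ∀ i : Fin I.k, inp.getD (4 + I.n + 2 * (I.n * I.n) + 2 * i) 0 = (T i).1
  speedDen : ∀ i : Fin I.k, inp.getD (4 + I.n + 2 * (I.n * I.n) + 2 * i + 1) 0 = (T i).2
  length : 4 + I.n + 2 * (I.n * I.n) + 2 * I.k ≤ inp.length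

/-- The code of an instance with the given fractions. -/
def instanceCode (I : HVRP) (D : Fin I.n → Fin I.n → ℕ × ℕ) (T : Fin I.k → ℕ × ℕ) : List ℕ :=
  [I.n, I.k, (I.depot : ℕ), I.Q] ++ List.ofFn I.q ++ codeMatrix D ++ codeVector T

lemma length_instanceCode (I : HVRP) (D : Fin I.n → Fin I.n → ℕ × ℕ) (T : Fin I.k → ℕ × ℕ) :
    (instanceCode I D T).length = 4 + I.n + 2 * (I.n * I.n) + 2 * I.k := by
  simp [instanceCode, length_codeVector, length_codeMatrix, mul_assoc]
  omega

lemma index_lt {n : ℕ} (u v : Fin n) : n * u + v < n * n :=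
  calc n * (u : ℕ) + v < n * u + n := Nat.add_lt_add_left v.2 _
    _ = n * (u + 1) := (Nat.mul_succ _ _).symm
    _ ≤ n * n := Nat.mul_le_mul_left _ u.2

/-- The arbitrary tail covers both inputs: the instance alone, and the instance followed by a
solution. -/
lemma layout_append (I : HVRP) (D : Fin I.n → Fin I.n → ℕ × ℕ) (T : Fin I.k → ℕ × ℕ)
    (rest : List ℕ) : Layout I D T (instanceCode I D T ++ rest) := by
  have hlen := length_instanceCode I D T
  have hpre : ∀ a, a < 4 + I.n + 2 * (I.n * I.n) + 2 * I.k →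
      (instanceCode I D T ++ rest).getD a 0 = (instanceCode I D T).getD a 0 := fun a ha =>
    List.getD_append _ _ _ _ (by omega)
  have l₁ : ([I.n, I.k, (I.depot : ℕ), I.Q] ++ List.ofFn I.q).length = 4 + I.n := by simp; omega
  have l₂ : ([I.n, I.k, (I.depot : ℕ), I.Q] ++ List.ofFn I.q ++ codeMatrix D).length =
      4 + I.n + 2 * (I.n * I.n) := by
    rw [List.length_append, l₁, length_codeMatrix, mul_assoc]
  have hD : ∀ a, a < 2 * (I.n * I.n) →
      (instanceCode I D T).getD (4 + I.n + a) 0 = (codeMatrix D).getD a 0 := fun a ha => by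
    rw [instanceCode, List.getD_append _ _ _ _ (by omega),
      List.getD_append_right _ _ _ _ (by omega), l₁, Nat.add_sub_cancel_left]
  have hT : ∀ a, (instanceCode I D T).getD (4 + I.n + 2 * (I.n * I.n) + a) 0 =
      (codeVector T).getD a 0 := fun a => by
    rw [instanceCode, List.getD_append_right _ _ _ _ (by omega), l₂, Nat.add_sub_cancel_left]
  constructor
  · rfl
  · rfl
  · rfl
  · rfl
  · intro v
    have := v.2
    rw [hpre _ (by omega), instanceCode, List.getD_append _ _ _ _ (by omega),
      List.getD_append _ _ _ _ (by omega), List.getD_append_right _ _ _ _ (by simp)]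
    simp
  · intro u v
    have := index_lt u v
    rw [hpre _ (by omega), hD _ (by omega), (getD_codeMatrix D u v).1]
  · intro u v
    have := index_lt u v
    rw [hpre _ (by omega), add_assoc (4 + I.n), hD _ (by omega), (getD_codeMatrix D u v).2]
  · intro i
    rw [hpre _ (by omega), hT, (getD_codeVector T i).1]
  · intro i
    rw [hpre _ (by omega), add_assoc (4 + I.n + _), hT, (getD_codeVector T i).2]
  · rw [List.length_append]
    omega

/-! ### Building the table of copies -/

instance : Add Expr := ⟨.add⟩
instance : Sub Expr := ⟨.sub⟩
instance : Mul Expr := ⟨.mul⟩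
instance : Div Expr := ⟨.div⟩

namespace Expr

variable (s : Store) (x y : Expr)

@[simp] lemma eval_add : (x + y).eval s = x.eval s + y.eval s := rfl
@[simp] lemma eval_sub : (x - y).eval s = x.eval s - y.eval s := rfl
@[simp] lemma eval_mul : (x * y).eval s = x.eval s * y.eval s := rfl
@[simp] lemma eval_div : (x / y).eval s = x.eval s / y.eval s := rfl
@[simp] lemma eval_const (c : ℕ) : (const c).eval s = c := rfl
@[simp] lemma eval_reg (i : ℕ) : (reg i).eval s = s.reg i := rfl
@[simp] lemma eval_load : (load x).eval s = s.mem (x.eval s) := rfl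
@[simp] lemma eval_lt : (lt x y).eval s = if x.eval s < y.eval s then 1 else 0 := rfl

/-- The power `x ^ b`. -/
def pow : ℕ → Expr
  | 0 => const 1
  | b + 1 => pow b * x

@[simp] lemma eval_pow (b : ℕ) : (x.pow b).eval s = x.eval s ^ b := by
  induction b with
  | zero => rfl
  | succ b ih => rw [pow, eval_mul, ih, pow_succ]

end Expr

infixr:30 " ;; " => Prog.seq

open HetVRP.Expr in
/-- Registers `0` to `6` receive the length of the input, the numbers of points and of vehicles,
the depot, the capacity, the scaled capacity and the load of a copy. -/
def Prog.readSizes (b : ℕ) : Prog :=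
  .assign 1 (load (const 0)) ;;
  .assign 2 (load (const 1)) ;;
  .assign 3 (load (const 2)) ;;
  .assign 4 (load (const 3)) ;;
  .assign 5 (reg 4 - (reg 4 - (reg 1).pow b)) ;;
  .assign 6 ((reg 4 + reg 5 - const 1) / reg 5)

open HetVRP.Expr in
/-- For each point of the reduced instance, its vertex and its load are stored in two consecutive
cells, behind the input; register `7` receives the number of points. -/
def Prog.buildTable : Prog :=
  .store (reg 0) (reg 3) ;;
  .store (reg 0 + const 1) (const 0) ;;
  .assign 7 (const 1) ;;
  .forLoop 8 1 (
    .assign 10 ((load (const 4 + reg 8) * reg 5 + reg 4 - const 1) / reg 4) ;;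
    .forLoop 9 10 (
      .store (reg 0 + const 2 * reg 7) (reg 8) ;;
      .store (reg 0 + const 2 * reg 7 + const 1)
        (reg 6 - (reg 6 - (load (const 4 + reg 8) - reg 9 * reg 6))) ;;
      .assign 7 (reg 7 + const 1)))

/-- The contents of the registers and cells that are not changed once the sizes are known. -/
structure Ready (I : HVRP) (b : ℕ) (inp : List ℕ) (s : Store) : Prop where
  reg0 : s.reg 0 = inp.length
  reg1 : s.reg 1 = I.n
  reg2 : s.reg 2 = I.k
  reg3 : s.reg 3 = I.depot
  reg4 : s.reg 4 = I.Q
  reg5 : s.reg 5 = I.scaledCapacity b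
  reg6 : s.reg 6 = I.copyLoad b
  mem : ∀ a < inp.length, s.mem a = inp.getD a 0

section Programs

variable {I : HVRP} {b : ℕ} {inp : List ℕ} {s : Store} {S : ℕ}
  {D : Fin I.n → Fin I.n → ℕ × ℕ} {T : Fin I.k → ℕ × ℕ}

lemma Ready.setReg (h : Ready I b inp s) {i : ℕ} (hi : 7 ≤ i) (x : ℕ) :
    Ready I b inp { s with reg := Function.update s.reg i x } := by
  have h' : ∀ j < 7, Function.update s.reg i x j = s.reg j := fun j hj =>
    Function.update_of_ne (by omega) _ _
  exact ⟨(h' 0 (by omega)).trans h.reg0, (h' 1 (by omega)).trans h.reg1,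
    (h' 2 (by omega)).trans h.reg2, (h' 3 (by omega)).trans h.reg3,
    (h' 4 (by omega)).trans h.reg4, (h' 5 (by omega)).trans h.reg5,
    (h' 6 (by omega)).trans h.reg6, h.mem⟩

lemma Ready.setMem (h : Ready I b inp s) {a : ℕ} (ha : inp.length ≤ a) (x : ℕ) :
    Ready I b inp { s with mem := Function.update s.mem a x } :=
  ⟨h.reg0, h.reg1, h.reg2, h.reg3, h.reg4, h.reg5, h.reg6, fun a' ha' => by
    rw [← h.mem a' ha']
    exact Function.update_of_ne (by omega) _ _⟩

lemma Ready.setOut (h : Ready I b inp s) (o : List ℕ) : Ready I b inp { s with out := o } :=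
  ⟨h.reg0, h.reg1, h.reg2, h.reg3, h.reg4, h.reg5, h.reg6, h.mem⟩

lemma runs_readSizes (hL : Layout I D T inp) :
    Runs S (.readSizes b) (initStore inp) fun s => Ready I b inp s ∧ s.out = [] := by
  refine .of_fits fun hS => ?_
  have hQ := hS.mem_lt 3
  have hn := hS.mem_lt 0
  have hk := hS.mem_lt 1
  have hr := hS.mem_lt 2
  -- The machine has no minimum; truncated subtraction gives min(x, y) = x - (x - y).
  have h₅ : I.Q - (I.Q - I.n ^ b) = I.scaledCapacity b := by
    unfold HVRP.scaledCapacity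
    omega
  have h₆ := (I.copyLoad_le b)
  have h₇ := I.scaledCapacity_le b
  simp only [initStore, hL.Q, hL.n, hL.k, hL.depot] at hQ hn hk hr
  refine .seq (.assign ?_ (.seq (.assign ?_ (.seq (.assign ?_ (.seq (.assign ?_
    (.seq (.assign ?_ (.assign ?_ ⟨?_, ?_⟩))))))))))
  all_goals simp only [Expr.eval_load, Expr.eval_const, Expr.eval_sub, Expr.eval_reg,
    Expr.eval_pow, Expr.eval_add, Expr.eval_div, initStore, hL.n, hL.k, hL.depot, hL.Q]
  · exact hn
  · exact hk
  · exact hr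
  · exact hQ
  · simp
    omega
  · simp [h₅]
    exact h₆.trans_lt hQ
  · constructor <;> simp [h₅, HVRP.copyLoad]

/-- The vertex and the load of a point of the reduced instance. -/
def copyEntry (I : HVRP) (b : ℕ) : Option (Σ v : Fin I.n, Fin (I.scaledDemand b v)) → ℕ × ℕ
  | none => (I.depot, 0)
  | some ⟨v, p⟩ => (v, I.copyAmount b v p)

/-- From address `a` on, the memory holds the entries of the points in `l`. -/
def HoldsTable (I : HVRP) (b a : ℕ) (mem : ℕ → ℕ)
    (l : List (Option (Σ v : Fin I.n, Fin (I.scaledDemand b v)))) : Prop :=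
  ∀ (j : ℕ) (h : j < l.length),
    mem (a + 2 * j) = (copyEntry I b l[j]).1 ∧ mem (a + 2 * j + 1) = (copyEntry I b l[j]).2

lemma HoldsTable.push {a : ℕ} {mem : ℕ → ℕ}
    {l : List (Option (Σ v : Fin I.n, Fin (I.scaledDemand b v)))} (h : HoldsTable I b a mem l)
    (x : Option (Σ v : Fin I.n, Fin (I.scaledDemand b v))) :
    HoldsTable I b a (Function.update (Function.update mem (a + 2 * l.length) (copyEntry I b x).1)
      (a + 2 * l.length + 1) (copyEntry I b x).2) (l ++ [x]) := by
  intro j hj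
  rw [List.length_append, List.length_singleton] at hj
  rcases Nat.lt_succ_iff_lt_or_eq.1 hj with hj' | rfl
  · rw [List.getElem_append_left hj', Function.update_of_ne (by omega),
      Function.update_of_ne (by omega), Function.update_of_ne (by omega),
      Function.update_of_ne (by omega)]
    exact h j hj'
  · rw [Function.update_of_ne (by omega)]
    simp

/-- The copies of `v`. -/
def copyBlock (I : HVRP) (b : ℕ) (v : Fin I.n) :
    List (Option (Σ v : Fin I.n, Fin (I.scaledDemand b v))) :=
  (List.finRange (I.scaledDemand b v)).map fun p => some ⟨v, p⟩

/-- The points of the reduced instance up to the copies of the first `j` vertices. -/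
def copyPrefix (I : HVRP) (b j : ℕ) :
    List (Option (Σ v : Fin I.n, Fin (I.scaledDemand b v))) :=
  none :: ((List.finRange I.n).take j).flatMap (copyBlock I b)

lemma take_finRange_succ {n : ℕ} (i : Fin n) :
    (List.finRange n).take (i + 1) = (List.finRange n).take i ++ [i] := by
  rw [← List.take_append_getElem (by simp)]
  simp

lemma copyPrefix_succ (v : Fin I.n) :
    copyPrefix I b (v + 1) = copyPrefix I b v ++ copyBlock I b v := by
  simp [copyPrefix, take_finRange_succ]

lemma copyPrefix_n : copyPrefix I b I.n = copyList I (I.scaledDemand b) := by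
  rw [copyPrefix, List.take_of_length_le (by simp)]
  rfl

lemma length_copyPrefix_le (j : ℕ) : (copyPrefix I b j).length ≤ (I.reduced b).n := by
  change _ ≤ (copyList I (I.scaledDemand b)).length
  refine List.Sublist.length_le (List.Sublist.cons_cons _ ?_)
  refine (?_ : _ <+: _).sublist
  refine ⟨((List.finRange I.n).drop j).flatMap (copyBlock I b), ?_⟩
  rw [← List.flatMap_append, List.take_append_drop]
  rfl

lemma runs_buildTable (hL : Layout I D T inp) (hready : Ready I b inp s) {o : List ℕ}
    (ho : s.out = o) (hN : (I.reduced b).n ≤ S) (hn : I.n ≤ S) :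
    Runs S .buildTable s fun s => Ready I b inp s ∧ s.out = o ∧ s.reg 7 = (I.reduced b).n ∧
      HoldsTable I b inp.length s.mem (copyList I (I.scaledDemand b)) := by
  refine .of_fits fun hS => ?_
  have hr := hready.reg3 ▸ hS.reg_lt 3
  have hQ := hready.reg4 ▸ hS.reg_lt 4
  have h₀ : 0 < 2 ^ S := by positivity
  have hN' : (I.reduced b).n < 2 ^ S := hN.trans_lt S.lt_two_pow_self
  have hn' : I.n < 2 ^ S := hn.trans_lt S.lt_two_pow_self
  have hJ : 1 ≤ (I.reduced b).n := (I.reduced b).depot.pos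
  refine .seq (.store (by simpa [hready.reg3] using hr) (.seq (.store (by simp)
    (.seq (.assign (by simp; omega) ?_)))))
  refine Runs.mono (Runs.forLoop (K := I.n) (fun j s => s.reg 8 = j ∧ Ready I b inp s ∧ s.out = o ∧
    s.reg 7 = (copyPrefix I b j).length ∧ HoldsTable I b inp.length s.mem (copyPrefix I b j))
    hn ?_ ?_ ?_) ?_
  · rintro j s ⟨h₁, h₂, -⟩
    exact ⟨h₁, h₂.reg1⟩
  · refine ⟨by simp, ?_, ho, ?_, ?_⟩
    · refine Ready.setReg (s := ⟨_, _, _⟩) (Ready.setReg (s := ⟨_, _, _⟩) (Ready.setMem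
        (s := ⟨_, _, _⟩) (Ready.setMem hready ?_ _) ?_ _) ?_ _) ?_ _ <;> simp [hready.reg0]
    · simp [copyPrefix]
    · have h := HoldsTable.push (I := I) (b := b) (a := inp.length) (mem := s.mem) (l := [])
        (fun j hj => by simp at hj) none
      simpa [copyPrefix, copyEntry, hready.reg0, hready.reg3] using h
  · rintro j hj s ⟨h8, hr, ho, h7, ht⟩
    obtain ⟨v, rfl⟩ : ∃ v : Fin I.n, (v : ℕ) = j := ⟨⟨j, hj⟩, rfl⟩
    have hq : s.mem (4 + v) = I.q v := by
      rw [hr.mem _ (by have := hL.length; omega), hL.q]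
    have hd : (I.q v * I.scaledCapacity b + I.Q - 1) / I.Q = I.scaledDemand b v :=
      (I.scaledDemand_eq b v).symm
    have hlen : (copyPrefix I b v).length + I.scaledDemand b v ≤ (I.reduced b).n := by
      have := length_copyPrefix_le (I := I) (b := b) (v + 1)
      rw [copyPrefix_succ, List.length_append] at this
      simpa [copyBlock] using this
    refine .seq (.assign (by simp [h8, hr.reg5, hr.reg4, hq, hd]; omega) ?_)
    simp only [Expr.eval_add, Expr.eval_sub, Expr.eval_mul, Expr.eval_div, Expr.eval_load,
      Expr.eval_const, Expr.eval_reg, h8, hr.reg5, hr.reg4, hq, hd]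
    refine Runs.mono (Runs.forLoop (K := I.scaledDemand b v) (fun p s => s.reg 9 = p ∧
      s.reg 10 = I.scaledDemand b v ∧ s.reg 8 = v ∧ Ready I b inp s ∧ s.out = o ∧
      s.reg 7 = (copyPrefix I b v).length + p ∧
      HoldsTable I b inp.length s.mem (copyPrefix I b v ++ (copyBlock I b v).take p))
      (by omega) ?_ ?_ ?_) ?_
    · rintro j s ⟨h₁, h₂, -⟩
      exact ⟨h₁, h₂⟩
    · refine ⟨by simp, by simp, by simp [h8], (hr.setReg (by simp) _).setReg (by simp) _, ho,
        by simp [h7], by simpa using ht⟩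
    · rintro p hp s ⟨h9, h10, h8, hr, ho, h7, ht⟩
      have hq : s.mem (4 + v) = I.q v := by
        rw [hr.mem _ (by have := hL.length; omega), hL.q]
      have hlen' : (copyPrefix I b v ++ (copyBlock I b v).take p).length =
          (copyPrefix I b v).length + p := by simp [copyBlock]; omega
      have hblock : (copyBlock I b v).take (p + 1) =
          (copyBlock I b v).take p ++ [some ⟨v, ⟨p, hp⟩⟩] := by
        rw [← List.take_append_getElem (by simpa [copyBlock] using hp)]
        simp [copyBlock]
      have hamt : I.copyLoad b - (I.copyLoad b - (I.q v - p * I.copyLoad b)) =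
          I.copyAmount b v p := by
        unfold HVRP.copyAmount
        omega
      have hm := I.copyLoad_le b
      -- The demand of v is read again after the vertex cell has been written; the table lies behind
      -- the input, so it is unchanged.
      have hne : 4 + (v : ℕ) ≠ inp.length + 2 * ((copyPrefix I b v).length + p) := by
        have := hL.length
        omega
      refine .seq (.store (by simp [h8]; omega) (.seq (.store ?_ (.assign ?_ ?_))))
      · simp [hr.reg6]
        omega
      · simp [h7]
        omega
      · simp only [Expr.eval_add, Expr.eval_sub, Expr.eval_mul, Expr.eval_load,
          Expr.eval_const, Expr.eval_reg, h8, h7, h9, hr.reg0, hr.reg6,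
          Function.update_of_ne hne, hq, hamt]
        refine ⟨by simp [h9], by simp, by simp [h10], by simp [h8], ?_, ho, by simp; omega, ?_⟩
        · refine Ready.setReg (s := ⟨_, _, _⟩) (Ready.setReg (s := ⟨_, _, _⟩) (Ready.setMem
            (s := ⟨_, _, _⟩) (Ready.setMem hr ?_ _) ?_ _) ?_ _) ?_ _ <;> omega
        · rw [hblock, ← List.append_assoc]
          have := ht.push (some ⟨v, ⟨p, hp⟩⟩)
          rw [hlen'] at this
          exact this
    · rintro s ⟨h9, h10, h8, hr, ho, h7, ht⟩
      refine ⟨h8, by simp, hr.setReg (by simp) _, ho, ?_, ?_⟩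
      · simp [copyPrefix_succ, h7, copyBlock]
      · rw [copyPrefix_succ]
        rwa [List.take_of_length_le (by simp [copyBlock])] at ht
  · rintro s ⟨-, hr, ho, h7, ht⟩
    rw [copyPrefix_n] at h7 ht
    exact ⟨hr, ho, h7, ht⟩

end Programs

/-! ### Writing the reduced instance -/

/-- For loops that append one block per round: the output is tracked here, so the caller's invariant
may ignore it and the counter. -/
lemma Runs.writeLoop {S : ℕ} {s : Store} {i r : ℕ} {c : Prog} (Inv : ℕ → Store → Prop) {K : ℕ}
    (g : Fin K → List ℕ) (hK : K ≤ S) (hr : ∀ j s, Inv j s → s.reg r = K)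
    (hset : ∀ j s x, Inv j s → Inv j { s with reg := Function.update s.reg i x }) (h : Inv 0 s)
    (hstep : ∀ (j : Fin K) (s), Inv j s → s.reg i = j → Runs S c s fun s' =>
      s'.reg i = j ∧ Inv (j + 1) s' ∧ s'.out = s.out ++ g j) :
    Runs S (.forLoop i r c) s fun s' =>
      Inv K s' ∧ s'.out = s.out ++ (List.finRange K).flatMap g := by
  refine Runs.mono (Runs.forLoop (K := K) (fun j s' => s'.reg i = j ∧ Inv j s' ∧
    s'.out = s.out ++ ((List.finRange K).take j).flatMap g) hK ?_ ?_ ?_) ?_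
  · rintro j s ⟨h₁, h₂, -⟩
    exact ⟨h₁, hr j s h₂⟩
  · exact ⟨by simp, hset _ _ _ h, by simp⟩
  · rintro j hj s₁ ⟨h₁, h₂, h₃⟩
    refine (hstep ⟨j, hj⟩ s₁ h₂ h₁).mono ?_
    rintro s₂ ⟨h₄, h₅, h₆⟩
    refine ⟨h₄, by simp, hset _ _ _ h₅, ?_⟩
    rw [take_finRange_succ ⟨j, hj⟩]
    simp [h₆, h₃]
  · rintro s' ⟨-, h₁, h₂⟩
    rw [List.take_of_length_le (by simp)] at h₂
    exact ⟨h₁, h₂⟩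

/-- Address of the numerator of the distance between the vertices `x` and `y`. -/
def Expr.distAddress (x y : Expr) : Expr :=
  .const 4 + .reg 1 + .const 2 * (.reg 1 * x + y)

/-- Numerator of the distance between the vertices `x` and `y`. -/
def Expr.distNum (x y : Expr) : Expr := .load (.distAddress x y)

/-- Denominator of the distance between the vertices `x` and `y`. -/
def Expr.distDen (x y : Expr) : Expr := .load (.distAddress x y + .const 1)

open HetVRP.Expr in
/-- Writes the distances between all points of the table. -/
def Prog.writeDistances : Prog :=
  .forLoop 8 7 (.forLoop 9 7 (
    .assign 10 (load (reg 0 + const 2 * reg 8)) ;;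
    .assign 11 (load (reg 0 + const 2 * reg 9)) ;;
    .write ((lt (reg 8) (reg 9) + lt (reg 9) (reg 8)) *
      (distNum (reg 3) (reg 10) * distDen (reg 10) (reg 11) * distDen (reg 3) (reg 11) +
        reg 5 * distDen (reg 3) (reg 10) * distNum (reg 10) (reg 11) * distDen (reg 3) (reg 11) +
        distDen (reg 3) (reg 10) * distDen (reg 10) (reg 11) * distNum (reg 3) (reg 11))) ;;
    .write (reg 5 * distDen (reg 3) (reg 10) * distDen (reg 10) (reg 11) *
      distDen (reg 3) (reg 11))))

open HetVRP.Expr in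
/-- Copies the speeds from the input. -/
def Prog.writeSpeeds : Prog :=
  .forLoop 8 2 (
    .write (load (const 4 + reg 1 + const 2 * (reg 1 * reg 1) + const 2 * reg 8)) ;;
    .write (load (const 4 + reg 1 + const 2 * (reg 1 * reg 1) + const 2 * reg 8 + const 1)))

open HetVRP.Expr in
/-- Computes the reduced instance. -/
def Prog.reduce (b : ℕ) : Prog :=
  .readSizes b ;; .buildTable ;; .write (reg 7) ;; .write (reg 2) ;; .write (const 0) ;;
  .writeDistances ;; .writeSpeeds

/-- From address `a` on, the memory holds the vertex of each point and the number of units that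
are still to be dropped there. -/
def HoldsPoints (I : HVRP) (b a : ℕ) (mem : ℕ → ℕ) (rem : Fin (I.reduced b).n → ℕ) : Prop :=
  ∀ i : Fin (I.reduced b).n,
    mem (a + 2 * i) = I.reducedVertex b i ∧ mem (a + 2 * i + 1) = rem i

section Programs

variable {I : HVRP} {b : ℕ} {inp : List ℕ} {s : Store} {S : ℕ}
  {D : Fin I.n → Fin I.n → ℕ × ℕ} {T : Fin I.k → ℕ × ℕ}

lemma HoldsTable.holdsPoints {a : ℕ} {mem : ℕ → ℕ}
    (h : HoldsTable I b a mem (copyList I (I.scaledDemand b))) :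
    HoldsPoints I b a mem (I.reducedAmount b) := fun i => by
  have h₁ : copyEntry I b (pointEquiv I (I.scaledDemand b) (I.scaledCapacity b) i) =
      ((I.reducedVertex b i : ℕ), I.reducedAmount b i) := by
    unfold HVRP.reducedVertex pointVertex HVRP.reducedAmount
    rcases pointEquiv I (I.scaledDemand b) (I.scaledCapacity b) i with _ | ⟨v, p⟩ <;> rfl
  have h₂ : mem (a + 2 * i) = (copyEntry I b (pointEquiv I _ (I.scaledCapacity b) i)).1 ∧
      mem (a + 2 * i + 1) = (copyEntry I b (pointEquiv I _ (I.scaledCapacity b) i)).2 := h i i.2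
  rwa [h₁] at h₂

lemma Ready.eval_distNum (h : Ready I b inp s) (hL : Layout I D T inp) {x y : Expr}
    {u v : Fin I.n} (hx : x.eval s = u) (hy : y.eval s = v) :
    (Expr.distNum x y).eval s = (D u v).1 := by
  have h₁ := hL.length
  have h₂ := index_lt u v
  simp only [Expr.distNum, Expr.distAddress, Expr.eval_load, Expr.eval_add, Expr.eval_mul,
    Expr.eval_const, Expr.eval_reg, hx, hy, h.reg1]
  rw [h.mem _ (by omega), hL.num]

lemma Ready.eval_distDen (h : Ready I b inp s) (hL : Layout I D T inp) {x y : Expr}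
    {u v : Fin I.n} (hx : x.eval s = u) (hy : y.eval s = v) :
    (Expr.distDen x y).eval s = (D u v).2 := by
  have h₁ := hL.length
  have h₂ := index_lt u v
  simp only [Expr.distDen, Expr.distAddress, Expr.eval_load, Expr.eval_add, Expr.eval_mul,
    Expr.eval_const, Expr.eval_reg, hx, hy, h.reg1]
  rw [h.mem _ (by omega), hL.den]

/-- The fractions that describe the distances of the reduced instance. -/
def reducedDistCode (I : HVRP) (b : ℕ) (D : Fin I.n → Fin I.n → ℕ × ℕ)
    (i j : Fin (I.reduced b).n) : ℕ × ℕ :=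
  let r := I.depot
  let u := I.reducedVertex b i
  let v := I.reducedVertex b j
  (((if (i : ℕ) < j then 1 else 0) + if (j : ℕ) < i then 1 else 0) *
    ((D r u).1 * (D u v).2 * (D r v).2 + I.scaledCapacity b * (D r u).2 * (D u v).1 * (D r v).2 +
      (D r u).2 * (D u v).2 * (D r v).1),
    I.scaledCapacity b * (D r u).2 * (D u v).2 * (D r v).2)

/-- The sum of two pendant lengths and a base distance over a common denominator, without
cancelling. -/
lemma isFrac_reducedDistCode (hD : ∀ u v, IsFrac (D u v) (I.d u v))
    (i j : Fin (I.reduced b).n) : IsFrac (reducedDistCode I b D i j) ((I.reduced b).d i j) := by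
  obtain ⟨h₁, e₁⟩ := hD I.depot (I.reducedVertex b i)
  obtain ⟨h₂, e₂⟩ := hD (I.reducedVertex b i) (I.reducedVertex b j)
  obtain ⟨h₃, e₃⟩ := hD I.depot (I.reducedVertex b j)
  have h₀ := (I.scaledCapacity_pos b).ne'
  refine ⟨mul_ne_zero (mul_ne_zero (mul_ne_zero h₀ h₁) h₂) h₃, ?_⟩
  rw [copyInstance_d]
  by_cases hij : i = j
  · simp [hij, reducedDistCode]
  -- The factor [i < j] + [j < i] tests i ≠ j; it gives distance 0 on the diagonal but not between
  -- different copies of one vertex.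
  · have h₄ : ((if (i : ℕ) < j then 1 else 0) + if (j : ℕ) < i then 1 else 0) = 1 := by
      have := fun h => hij (Fin.ext h)
      split_ifs <;> omega
    have c₀ : (I.scaledCapacity b : ℚ) ≠ 0 := by exact_mod_cast h₀
    have c₁ : ((D I.depot (I.reducedVertex b i)).2 : ℚ) ≠ 0 := by exact_mod_cast h₁
    have c₂ : ((D (I.reducedVertex b i) (I.reducedVertex b j)).2 : ℚ) ≠ 0 := by
      exact_mod_cast h₂
    have c₃ : ((D I.depot (I.reducedVertex b j)).2 : ℚ) ≠ 0 := by exact_mod_cast h₃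
    rw [if_neg hij, pointPendant, pointPendant, e₁, e₂, e₃]
    simp only [reducedDistCode, h₄, one_mul]
    push_cast
    field_simp

/-- `rem` is arbitrary because only the vertex cells of the table are read. -/
lemma runs_writeDistances (hL : Layout I D T inp) (hready : Ready I b inp s)
    (h7 : s.reg 7 = (I.reduced b).n) {rem : Fin (I.reduced b).n → ℕ}
    (hp : HoldsPoints I b inp.length s.mem rem) (hN : (I.reduced b).n ≤ S) :
    Runs S .writeDistances s fun s' =>
      Ready I b inp s' ∧ s'.out = s.out ++ codeMatrix (reducedDistCode I b D) := by
  refine Runs.mono (Runs.writeLoop (K := (I.reduced b).n) (fun _ s => Ready I b inp s ∧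
    s.reg 7 = (I.reduced b).n ∧ HoldsPoints I b inp.length s.mem rem)
    (fun i => codeVector (reducedDistCode I b D i)) hN (fun _ s h => h.2.1) ?_
    ⟨hready, h7, hp⟩ ?_) fun s' h => ⟨h.1.1, h.2⟩
  · rintro _ s x ⟨h₁, h₂, h₃⟩
    exact ⟨h₁.setReg (by decide) x, by simpa using h₂, h₃⟩
  rintro i s ⟨hr, h7, hp⟩ h8
  refine Runs.mono (Runs.writeLoop (K := (I.reduced b).n) (fun _ s => Ready I b inp s ∧
    s.reg 7 = (I.reduced b).n ∧ s.reg 8 = i ∧ HoldsPoints I b inp.length s.mem rem)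
    (fun j => [(reducedDistCode I b D i j).1, (reducedDistCode I b D i j).2]) hN
    (fun _ s h => h.2.1) ?_ ⟨hr, h7, h8, hp⟩ ?_)
    fun s' h => ⟨h.1.2.2.1, ⟨h.1.1, h.1.2.1, h.1.2.2.2⟩, h.2⟩
  · rintro _ s x ⟨h₁, h₂, h₃, h₄⟩
    exact ⟨h₁.setReg (by decide) x, by simpa using h₂, by simpa using h₃, h₄⟩
  rintro j s ⟨hr, h7, h8, hp⟩ h9
  refine .of_fits fun hS => .seq (Runs.mono (Q := fun s₁ => Ready I b inp s₁ ∧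
    s₁.reg 7 = (I.reduced b).n ∧ s₁.reg 8 = i ∧ s₁.reg 9 = j ∧ s₁.reg 10 = I.reducedVertex b i ∧
    HoldsPoints I b inp.length s₁.mem rem ∧ s₁.out = s.out) (.assign (hS.mem_lt _) ?_) ?_)
  · exact ⟨hr.setReg (by decide) _, by simpa using h7, by simpa using h8, by simpa using h9,
      by simpa [h8, hr.reg0] using (hp i).1, hp, rfl⟩
  rintro s₁ ⟨hr₁, h7, h8, h9, h10, hp₁, ho₁⟩
  refine .of_fits fun hS => .seq (Runs.mono (Q := fun s₂ => Ready I b inp s₂ ∧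
    s₂.reg 7 = (I.reduced b).n ∧ s₂.reg 8 = i ∧ s₂.reg 9 = j ∧ s₂.reg 10 = I.reducedVertex b i ∧
    s₂.reg 11 = I.reducedVertex b j ∧ HoldsPoints I b inp.length s₂.mem rem ∧ s₂.out = s.out)
    (.assign (hS.mem_lt _) ?_) ?_)
  · exact ⟨hr₁.setReg (by decide) _, by simpa using h7, by simpa using h8, by simpa using h9,
      by simpa using h10, by simpa [h9, hr₁.reg0] using (hp₁ j).1, hp₁, ho₁⟩
  rintro s₂ ⟨hr₂, g7, g8, g9, g10, g11, hp₂, ho₂⟩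
  refine .seq (Runs.mono (Q := fun s₃ => Ready I b inp s₃ ∧
    s₃.reg 7 = (I.reduced b).n ∧ s₃.reg 8 = i ∧ s₃.reg 9 = j ∧ s₃.reg 10 = I.reducedVertex b i ∧
    s₃.reg 11 = I.reducedVertex b j ∧ HoldsPoints I b inp.length s₃.mem rem ∧
    s₃.out = s.out ++ [(reducedDistCode I b D i j).1]) (.write ?_) ?_)
  · refine ⟨hr₂.setOut _, g7, g8, g9, g10, g11, hp₂, ?_⟩
    have k3 : (Expr.reg 3).eval s₂ = I.depot := hr₂.reg3
    have k10 : (Expr.reg 10).eval s₂ = I.reducedVertex b i := g10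
    have k11 : (Expr.reg 11).eval s₂ = I.reducedVertex b j := g11
    simp only [Expr.eval_mul, Expr.eval_add, Expr.eval_lt, hr₂.eval_distNum hL k3 k10,
      hr₂.eval_distNum hL k3 k11, hr₂.eval_distNum hL k10 k11, hr₂.eval_distDen hL k3 k10,
      hr₂.eval_distDen hL k3 k11, hr₂.eval_distDen hL k10 k11, Expr.eval_reg, hr₂.reg5, g8, g9,
      ho₂, reducedDistCode]
  rintro s₃ ⟨hr₃, g7, g8, g9, g10, g11, hp₃, ho₃⟩
  refine .write ⟨g9, ⟨hr₃.setOut _, g7, g8, hp₃⟩, ?_⟩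
  have k3 : (Expr.reg 3).eval s₃ = I.depot := hr₃.reg3
  have k10 : (Expr.reg 10).eval s₃ = I.reducedVertex b i := g10
  have k11 : (Expr.reg 11).eval s₃ = I.reducedVertex b j := g11
  simp only [Expr.eval_mul, hr₃.eval_distDen hL k3 k10, hr₃.eval_distDen hL k3 k11,
    hr₃.eval_distDen hL k10 k11, Expr.eval_reg, hr₃.reg5, ho₃, reducedDistCode]
  rw [List.append_assoc]
  rfl

lemma runs_writeSpeeds (hL : Layout I D T inp) (hready : Ready I b inp s) (hk : I.k ≤ S) :
    Runs S .writeSpeeds s fun s' => s'.out = s.out ++ codeVector T := by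
  refine Runs.mono (Runs.writeLoop (K := I.k) (fun _ s => Ready I b inp s)
    (fun i => [(T i).1, (T i).2]) hk (fun _ s h => h.reg2)
    (fun _ s x h => h.setReg (by decide) x) hready ?_) fun s' h => h.2
  rintro i s hr h8
  have h₁ := hL.length
  refine .seq (.write (.write ⟨h8, (hr.setOut _).setOut _, ?_⟩))
  simp only [Expr.eval_load, Expr.eval_add, Expr.eval_mul, Expr.eval_const, Expr.eval_reg, h8,
    hr.reg1]
  rw [hr.mem _ (by omega), hr.mem _ (by omega), hL.speedNum, hL.speedDen]
  simp

/-- The code of the reduced instance that is computed from a code of the instance. -/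
def reducedCode (I : HVRP) (b : ℕ) (D : Fin I.n → Fin I.n → ℕ × ℕ) (T : Fin I.k → ℕ × ℕ) :
    List ℕ :=
  [(I.reduced b).n, I.k, 0] ++ codeMatrix (reducedDistCode I b D) ++ codeVector T

lemma isCode_reducedCode (hD : ∀ u v, IsFrac (D u v) (I.d u v))
    (hT : ∀ i, IsFrac (T i) (I.speed i)) : (I.reduced b).IsCode (reducedCode I b D T) :=
  ⟨reducedDistCode I b D, T, isFrac_reducedDistCode hD, hT, rfl⟩

lemma runs_reduce (hL : Layout I D T inp) (hN : (I.reduced b).n ≤ S) (hlen : inp.length ≤ S) :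
    Runs S (.reduce b) (initStore inp) fun s => s.out = reducedCode I b D T := by
  have h₁ := hL.length
  refine .seq ((runs_readSizes hL).mono ?_)
  rintro s ⟨hr, ho⟩
  refine .seq ((runs_buildTable hL hr ho hN (by omega)).mono ?_)
  rintro s ⟨hr, ho, h7, ht⟩
  refine .seq (.write (.seq (.write (.seq (.write (.seq ?_))))))
  refine Runs.mono (runs_writeDistances hL (by exact ((hr.setOut _).setOut _).setOut _)
    (by exact h7) (by exact ht.holdsPoints) hN) ?_
  rintro s' ⟨hr', ho'⟩
  refine (runs_writeSpeeds hL hr' (by omega)).mono ?_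
  rintro s'' ho''
  rw [ho'', ho']
  simp [ho, h7, hr.reg2, reducedCode]

end Programs

/-! ### Converting a solution -/

open HetVRP.Expr in
/-- Performs the visit of one point: its number is read at the address in register `8`, the load
of the vehicle is kept in register `11`. -/
def Prog.serve : Prog :=
  .assign 13 (load (reg 8)) ;;
  .assign 8 (reg 8 + const 1) ;;
  .assign 14 (load (reg 0 + const 2 * reg 13)) ;;
  .assign 15 (load (reg 0 + const 2 * reg 13 + const 1)) ;;
  .store (reg 0 + const 2 * reg 13 + const 1) (const 0) ;;
  .assign 16 (lt (reg 11) (reg 6)) ;;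
  .write (reg 16 * reg 3 + (const 1 - reg 16) * reg 14) ;;
  .write (reg 16 * (reg 4 - reg 11)) ;;
  .write (const 0) ;;
  .write (reg 14) ;;
  .write (const 0) ;;
  .write (reg 15) ;;
  .assign 11 (reg 16 * reg 4 + (const 1 - reg 16) * reg 11 - reg 15)

open HetVRP.Expr in
/-- Converts a solution of the reduced instance. -/
def Prog.convert (b : ℕ) : Prog :=
  .readSizes b ;; .buildTable ;;
  .assign 8 (const 4 + reg 1 + const 2 * (reg 1 * reg 1) + const 2 * reg 2) ;;
  .forLoop 9 2 (
    .assign 10 (load (reg 8)) ;;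
    .assign 8 (reg 8 + const 1) ;;
    .assign 11 (const 0) ;;
    .write (const 2 * reg 10) ;;
    .forLoop 12 10 .serve)

/-- Code of a stop. -/
def stopCode {n : ℕ} (s : Stop n) : List ℕ := [(s.vertex : ℕ), s.pick, s.drop]

section Programs

variable {I : HVRP} {b : ℕ} {inp : List ℕ} {s : Store} {S : ℕ}
  {D : Fin I.n → Fin I.n → ℕ × ℕ} {T : Fin I.k → ℕ × ℕ}

lemma HoldsPoints.clear {a : ℕ} {mem : ℕ → ℕ} {rem : Fin (I.reduced b).n → ℕ}
    (h : HoldsPoints I b a mem rem) (x : Fin (I.reduced b).n) :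
    HoldsPoints I b a (Function.update mem (a + 2 * x + 1) 0) (Function.update rem x 0) :=
  fun y => by
    rw [Function.update_of_ne (by omega)]
    refine ⟨(h y).1, ?_⟩
    rcases eq_or_ne y x with rfl | hyx
    · simp
    · rw [Function.update_of_ne hyx, Function.update_of_ne]
      · exact (h y).2
      · have := fun e => hyx (Fin.ext e)
        omega

lemma runs_serve (hready : Ready I b inp s) {rem : Fin (I.reduced b).n → ℕ}
    (hp : HoldsPoints I b inp.length s.mem rem) {pos load : ℕ} (x : Fin (I.reduced b).n)
    (h8 : s.reg 8 = pos) (h11 : s.reg 11 = load) (hload : load ≤ I.Q)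
    (hpos : pos < inp.length) (hx : inp.getD pos 0 = x) (hlen : inp.length ≤ S) :
    Runs S .serve s fun s' => s'.reg 9 = s.reg 9 ∧ s'.reg 10 = s.reg 10 ∧ s'.reg 12 = s.reg 12 ∧
      Ready I b inp s' ∧ HoldsPoints I b inp.length s'.mem (Function.update rem x 0) ∧
      s'.reg 8 = pos + 1 ∧
      s'.reg 11 = (if load < I.copyLoad b then I.Q else load) - rem x ∧
      s'.out = s.out ++
        (stopCode (if load < I.copyLoad b then (⟨I.depot, I.Q - load, 0⟩ : Stop I.n)
          else ⟨I.reducedVertex b x, 0, 0⟩) ++ stopCode (⟨I.reducedVertex b x, 0, rem x⟩)) := by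
  refine .of_fits fun hS => ?_
  have hQ := hready.reg4 ▸ hS.reg_lt 4
  have h₀ : 1 < 2 ^ S := Nat.one_lt_two_pow (by omega)
  have hlen' : inp.length < 2 ^ S := hlen.trans_lt S.lt_two_pow_self
  have hx' : s.mem pos = x := by rw [hready.mem _ hpos, hx]
  refine .seq (Runs.mono (Q := fun s₁ => s₁.reg 9 = s.reg 9 ∧ s₁.reg 10 = s.reg 10 ∧
    s₁.reg 12 = s.reg 12 ∧ Ready I b inp s₁ ∧ HoldsPoints I b inp.length s₁.mem rem ∧
    s₁.reg 8 = pos ∧ s₁.reg 11 = load ∧ s₁.reg 13 = x ∧ s₁.out = s.out)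
    (.assign (hS.mem_lt _) ?_) ?_)
  · exact ⟨by simp, by simp, by simp, hready.setReg (by decide) _, hp, by simp [h8],
      by simp [h11], by simp [h8, hx'], rfl⟩
  rintro s₁ ⟨g9, g10, g12, hr, hp, g8, g11, g13, ho⟩
  refine .seq (Runs.mono (Q := fun s₁ => s₁.reg 9 = s.reg 9 ∧ s₁.reg 10 = s.reg 10 ∧
    s₁.reg 12 = s.reg 12 ∧ Ready I b inp s₁ ∧ HoldsPoints I b inp.length s₁.mem rem ∧
    s₁.reg 8 = pos + 1 ∧ s₁.reg 11 = load ∧ s₁.reg 13 = x ∧ s₁.out = s.out)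
    (.assign (by simp [g8]; omega) ?_) ?_)
  · exact ⟨by simp [g9], by simp [g10], by simp [g12], hr.setReg (by decide) _, hp,
      by simp [g8], by simp [g11], by simp [g13], ho⟩
  clear g9 g10 g12 hr g8 g11 g13 ho
  rintro s₂ ⟨g9, g10, g12, hr, hp, g8, g11, g13, ho⟩
  refine .of_fits fun hS => .seq (Runs.mono (Q := fun s₁ => s₁.reg 9 = s.reg 9 ∧
    s₁.reg 10 = s.reg 10 ∧ s₁.reg 12 = s.reg 12 ∧ Ready I b inp s₁ ∧
    HoldsPoints I b inp.length s₁.mem rem ∧ s₁.reg 8 = pos + 1 ∧ s₁.reg 11 = load ∧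
    s₁.reg 13 = x ∧ s₁.reg 14 = I.reducedVertex b x ∧ s₁.out = s.out)
    (.assign (hS.mem_lt _) ?_) ?_)
  · exact ⟨by simp [g9], by simp [g10], by simp [g12], hr.setReg (by decide) _, hp,
      by simp [g8], by simp [g11], by simp [g13], by simp [hr.reg0, g13, hp x], ho⟩
  clear g9 g10 g12 hr g8 g11 g13 ho
  rintro s₃ ⟨g9, g10, g12, hr, hp, g8, g11, g13, g14, ho⟩
  refine .of_fits fun hS => .seq (Runs.mono (Q := fun s₁ => s₁.reg 9 = s.reg 9 ∧
    s₁.reg 10 = s.reg 10 ∧ s₁.reg 12 = s.reg 12 ∧ Ready I b inp s₁ ∧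
    HoldsPoints I b inp.length s₁.mem rem ∧ s₁.reg 8 = pos + 1 ∧ s₁.reg 11 = load ∧
    s₁.reg 13 = x ∧ s₁.reg 14 = I.reducedVertex b x ∧ s₁.reg 15 = rem x ∧ s₁.out = s.out)
    (.assign (hS.mem_lt _) ?_) ?_)
  · exact ⟨by simp [g9], by simp [g10], by simp [g12], hr.setReg (by decide) _, hp,
      by simp [g8], by simp [g11], by simp [g13], by simp [g14], by simp [hr.reg0, g13, hp x], ho⟩
  clear g9 g10 g12 hr g8 g11 g13 g14 ho
  rintro s₄ ⟨g9, g10, g12, hr, hp, g8, g11, g13, g14, g15, ho⟩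
  -- The remaining amount is already saved in register 15 when its cell is cleared.
  refine .seq (Runs.mono (Q := fun s₁ => s₁.reg 9 = s.reg 9 ∧
    s₁.reg 10 = s.reg 10 ∧ s₁.reg 12 = s.reg 12 ∧ Ready I b inp s₁ ∧
    HoldsPoints I b inp.length s₁.mem (Function.update rem x 0) ∧ s₁.reg 8 = pos + 1 ∧
    s₁.reg 11 = load ∧ s₁.reg 14 = I.reducedVertex b x ∧ s₁.reg 15 = rem x ∧ s₁.out = s.out)
    (.store (by simp) ?_) ?_)
  · refine ⟨g9, g10, g12, hr.setMem ?_ _, ?_, g8, g11, g14, g15, ho⟩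
    · simp [hr.reg0]
      omega
    · simpa [hr.reg0, g13] using hp.clear x
  clear g9 g10 g12 hr g8 g11 g13 g14 g15 ho
  rintro s₅ ⟨g9, g10, g12, hr, hp, g8, g11, g14, g15, ho⟩
  refine .seq (Runs.mono (Q := fun s₁ => s₁.reg 9 = s.reg 9 ∧
    s₁.reg 10 = s.reg 10 ∧ s₁.reg 12 = s.reg 12 ∧ Ready I b inp s₁ ∧
    HoldsPoints I b inp.length s₁.mem (Function.update rem x 0) ∧ s₁.reg 8 = pos + 1 ∧
    s₁.reg 11 = load ∧ s₁.reg 14 = I.reducedVertex b x ∧ s₁.reg 15 = rem x ∧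
    s₁.reg 16 = (if load < I.copyLoad b then 1 else 0) ∧ s₁.out = s.out) (.assign ?_ ?_) ?_)
  · rw [Expr.eval_lt]
    split_ifs <;> omega
  · exact ⟨by simp [g9], by simp [g10], by simp [g12], hr.setReg (by decide) _, hp, by simp [g8],
      by simp [g11], by simp [g14], by simp [g15], by simp [g11, hr.reg6], ho⟩
  clear g9 g10 g12 hr g8 g11 g14 g15 ho
  rintro s₆ ⟨g9, g10, g12, hr, hp, g8, g11, g14, g15, g16, ho⟩
  refine .seq (.write (.seq (.write (.seq (.write (.seq (.write (.seq (.write (.seq (.write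
    (.assign ?_ ⟨?_, ?_, ?_, ?_, ?_, ?_, ?_, ?_⟩))))))))))))
  · simp only [Expr.eval_sub, Expr.eval_add, Expr.eval_mul, Expr.eval_reg, Expr.eval_const, g11,
      g15, g16, hr.reg4]
    split_ifs <;> omega
  · simpa using g9
  · simpa using g10
  · simpa using g12
  · exact Ready.setReg (s := ⟨s₆.reg, s₆.mem, _⟩) (hr.setOut _) (by decide) _
  · exact hp
  · simpa using g8
  · simp only [Function.update_self, Expr.eval_sub, Expr.eval_add, Expr.eval_mul, Expr.eval_reg,
      Expr.eval_const, g11, g15, g16, hr.reg4]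
    split_ifs <;> simp
  · simp only [Expr.eval_sub, Expr.eval_add, Expr.eval_mul, Expr.eval_reg,
      Expr.eval_const, g11, g14, g15, g16, hr.reg3, hr.reg4, ho]
    split_ifs <;> simp [stopCode]

/-- The invariant looks forward: the output so far followed by the route for the points still to
come is the final output, and likewise for the remaining amounts. Nothing has to be said about
prefixes of a route. -/
lemma runs_serveLoop (hready : Ready I b inp s) {rem : Fin (I.reduced b).n → ℕ}
    (hp : HoldsPoints I b inp.length s.mem rem) (hrem : ∀ y, rem y ≤ I.copyLoad b) {pos : ℕ}
    (l : List (Fin (I.reduced b).n)) (h8 : s.reg 8 = pos) (h10 : s.reg 10 = l.length)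
    (h11 : s.reg 11 = 0) (hpos : pos + l.length ≤ inp.length)
    (hl : ∀ (j : ℕ) (hj : j < l.length), inp.getD (pos + j) 0 = l[j]) (hlen : inp.length ≤ S) :
    Runs S (.forLoop 12 10 .serve) s fun s' => s'.reg 9 = s.reg 9 ∧ Ready I b inp s' ∧
      HoldsPoints I b inp.length s'.mem (fun y => if y ∈ l then 0 else rem y) ∧
      s'.reg 8 = pos + l.length ∧
      s'.out = s.out ++
        (route I (I.copyLoad b) (I.reducedVertex b) rem 0 l).flatMap stopCode := by
  refine Runs.mono (Runs.forLoop (K := l.length) (fun j s' => s'.reg 12 = j ∧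
    s'.reg 10 = l.length ∧ s'.reg 9 = s.reg 9 ∧ Ready I b inp s' ∧ s'.reg 8 = pos + j ∧
    ∃ rem' load, s'.reg 11 = load ∧ load ≤ I.Q ∧ (∀ y, rem' y ≤ I.copyLoad b) ∧
      HoldsPoints I b inp.length s'.mem rem' ∧
      s'.out ++ (route I (I.copyLoad b) (I.reducedVertex b) rem' load (l.drop j)).flatMap stopCode =
        s.out ++ (route I (I.copyLoad b) (I.reducedVertex b) rem 0 l).flatMap stopCode ∧
      ∀ y, (if y ∈ l.drop j then 0 else rem' y) = if y ∈ l then 0 else rem y)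
    (by omega) (fun j s h => ⟨h.1, h.2.1⟩) ?_ ?_) ?_
  · exact ⟨by simp, by simp [h10], by simp, hready.setReg (by decide) _, by simp [h8],
      rem, 0, by simp [h11], Nat.zero_le _, hrem, hp, rfl, fun y => rfl⟩
  · rintro j hj s' ⟨h12, h10, h9, hr, h8, rem', load, h11, hload, hrem', hp', hout, hfin⟩
    have hm := I.copyLoad_le b
    refine (runs_serve hr hp' l[j] h8 h11 hload (by omega) (hl j hj) hlen).mono ?_
    rintro s'' ⟨g9, g10, g12, hr, hp, g8, g11, ho⟩
    refine ⟨g12.trans h12, by simp, by simp [g10, h10], by simp [g9, h9], hr.setReg (by decide) _,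
      by simp [g8, add_assoc], Function.update rem' l[j] 0, _, by simpa using g11, ?_,
      update_zero_le hrem' _, hp, ?_, fun y => ?_⟩
    · split_ifs <;> omega
    · rw [← hout, List.drop_eq_getElem_cons hj, route, ho]
      simp
    · rw [← hfin y, List.drop_eq_getElem_cons hj]
      by_cases hy : y = l[j]
      · subst hy
        simp only [List.mem_cons, true_or, if_true, Function.update_self, ite_self]
      · simp only [List.mem_cons, hy, false_or, Function.update_of_ne hy]
  · rintro s' ⟨-, -, h9, hr, h8, rem', load, -, -, -, hp, hout, hfin⟩
    refine ⟨h9, hr, ?_, h8, by simpa [route] using hout⟩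
    have : rem' = fun y => if y ∈ l then 0 else rem y := by
      funext y
      simpa using hfin y
    rwa [← this]

/-- The part of the code of a solution that belongs to one vehicle. -/
def tourCode {J : HTSP} (τ : J.Solution) (i : Fin J.k) : List ℕ :=
  (τ i).length :: (τ i).map fun v => (v : ℕ)

lemma tourCode_eq {J : HTSP} (τ : J.Solution) (i : Fin J.k) :
    tourCode τ i = (τ i).length :: List.map Fin.val (τ i) := by
  simp [tourCode, List.map_eq_flatMap]

/-- Length of the code of the first `i` tours. -/
def tourOffset {J : HTSP} (τ : J.Solution) (i : ℕ) : ℕ :=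
  (((List.finRange J.k).take i).flatMap (tourCode τ)).length

lemma tourOffset_succ {J : HTSP} (τ : J.Solution) (i : Fin J.k) :
    tourOffset τ (i + 1) = tourOffset τ i + 1 + (τ i).length := by
  simp [tourOffset, take_finRange_succ, tourCode]
  omega

lemma tourOffset_le {J : HTSP} (τ : J.Solution) (i : ℕ) :
    tourOffset τ i ≤ (J.codeSolution τ).length := by
  change _ ≤ ((List.finRange J.k).flatMap (tourCode τ)).length
  conv_rhs => rw [← List.take_append_drop i (List.finRange J.k), List.flatMap_append,
    List.length_append]
  exact Nat.le_add_right _ _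

lemma getD_codeSolution {J : HTSP} (τ : J.Solution) (i : Fin J.k) {j : ℕ}
    (hj : j < (tourCode τ i).length) :
    (J.codeSolution τ).getD (tourOffset τ i + j) 0 = (tourCode τ i).getD j 0 := by
  have h : J.codeSolution τ = ((List.finRange J.k).take i).flatMap (tourCode τ) ++
      (tourCode τ i ++ ((List.finRange J.k).drop (i + 1)).flatMap (tourCode τ)) := by
    change (List.finRange J.k).flatMap (tourCode τ) = _
    conv_lhs => rw [← List.take_append_drop i (List.finRange J.k), List.flatMap_append,
      List.drop_eq_getElem_cons (by simp), List.flatMap_cons]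
    simp
  rw [h, List.getD_append_right _ _ _ _ (by unfold tourOffset; omega), tourOffset,
    Nat.add_sub_cancel_left, List.getD_append _ _ _ _ hj]

/-- Matches the table left behind by one vehicle with the one the next vehicle starts from: cells
cleared in memory realize `remaining` without any bookkeeping of vehicles. -/
lemma remaining_succ (τ : (I.reduced b).Solution) (i : Fin I.k) :
    HVRP.remaining τ (i + 1) = fun y => if y ∈ τ i then 0 else HVRP.remaining τ i y := by
  funext y
  have h : (∃ j : Fin I.k, (j : ℕ) < i + 1 ∧ y ∈ τ j) ↔
      y ∈ τ i ∨ ∃ j : Fin I.k, (j : ℕ) < i ∧ y ∈ τ j := by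
    constructor
    · rintro ⟨j, hj, hy⟩
      rcases Nat.lt_succ_iff_lt_or_eq.1 hj with hj | hj
      · exact .inr ⟨j, hj, hy⟩
      · exact .inl (Fin.ext hj ▸ hy)
    · rintro (hy | ⟨j, hj, hy⟩)
      · exact ⟨i, Nat.lt_succ_self _, hy⟩
      · exact ⟨j, by omega, hy⟩
  by_cases hy : y ∈ τ i
  · exact (if_pos (h.2 (.inl hy))).trans (if_pos hy).symm
  · refine Eq.trans ?_ (if_neg hy).symm
    by_cases hj : ∃ j : Fin I.k, (j : ℕ) < i ∧ y ∈ τ j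
    · exact (if_pos (h.2 (.inr hj))).trans (if_pos hj).symm
    · exact (if_neg fun h' => (h.1 h').elim hy hj).trans (if_neg hj).symm

lemma remaining_zero (τ : (I.reduced b).Solution) :
    HVRP.remaining τ 0 = I.reducedAmount b := by
  funext y
  simp [HVRP.remaining]

lemma codeSolution_expand (τ : (I.reduced b).Solution) :
    I.codeSolution (HVRP.expand τ) = (List.finRange I.k).flatMap fun i =>
      2 * (τ i).length :: (HVRP.expand τ i).flatMap stopCode := by
  simp only [HVRP.codeSolution, HVRP.expand, length_route]
  rfl

lemma runs_convert (τ : (I.reduced b).Solution)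
    (hinp : inp = instanceCode I D T ++ (I.reduced b).codeSolution τ)
    (hN : (I.reduced b).n ≤ S) (hlen : inp.length ≤ S) :
    Runs S (.convert b) (initStore inp) fun s =>
      s.out = I.codeSolution (HVRP.expand τ) := by
  have hL : Layout I D T inp := hinp ▸ layout_append I D T _
  have h₁ := hL.length
  have hlen' : inp.length < 2 ^ S := hlen.trans_lt S.lt_two_pow_self
  set W := 4 + I.n + 2 * (I.n * I.n) + 2 * I.k with hW
  have hWlen : (instanceCode I D T).length = W := length_instanceCode I D T
  have hinplen : inp.length = W + ((I.reduced b).codeSolution τ).length := by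
    rw [hinp, List.length_append, hWlen]
  have hget : ∀ (i : Fin I.k) (j : ℕ), j < (tourCode τ i).length →
      inp.getD (W + tourOffset τ i + j) 0 = (tourCode τ i).getD j 0 := fun i j hj => by
    rw [hinp, add_assoc, List.getD_append_right _ _ _ _ (by omega), hWlen,
      Nat.add_sub_cancel_left]
    exact getD_codeSolution τ i hj
  refine .seq ((runs_readSizes hL).mono ?_)
  rintro s ⟨hr, ho⟩
  refine .seq ((runs_buildTable hL hr ho hN (by omega)).mono ?_)
  rintro s ⟨hr, ho, -, ht⟩
  refine .seq (.assign (by simp [hr.reg1, hr.reg2]; omega) ?_)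
  refine Runs.mono (Runs.writeLoop (K := I.k) (fun i s => Ready I b inp s ∧
    s.reg 8 = W + tourOffset τ i ∧
    HoldsPoints I b inp.length s.mem (HVRP.remaining τ i))
    (fun i => 2 * (τ i).length :: (HVRP.expand τ i).flatMap stopCode) (by omega)
    (fun _ s h => h.1.reg2) ?_ ?_ ?_) ?_
  · rintro _ s x ⟨g₁, g₂, g₃⟩
    exact ⟨g₁.setReg (by decide) x, by simpa using g₂, g₃⟩
  · refine ⟨hr.setReg (by decide) _, by simp [hr.reg1, hr.reg2, tourOffset, hW], ?_⟩
    rw [remaining_zero]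
    exact ht.holdsPoints
  · rintro i s ⟨hr, h8, hp⟩ h9
    have hsucc := tourOffset_succ τ i
    have hle := tourOffset_le τ (i + 1)
    have h₂ : s.mem (W + tourOffset τ i) = (τ i).length := by
      rw [hr.mem _ (by omega)]
      exact hget i 0 (by simp [tourCode])
    refine .of_fits fun hS => .seq (.assign (hS.mem_lt _) (.seq (.assign ?_ (.seq (.assign ?_
      (.seq (.write ?_)))))))
    · simp [h8]
      omega
    · simp
    · refine Runs.mono (runs_serveLoop (pos := W + tourOffset τ i + 1) (rem := HVRP.remaining τ i)
        (by exact Ready.setOut (s := ⟨_, s.mem, s.out⟩) (((hr.setReg (by decide) _).setReg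
          (by decide) _).setReg (by decide) _) _) (by exact hp)
        (fun y => (HVRP.remaining_le τ i y).trans (I.reducedAmount_le b y)) (τ i) ?_ ?_ ?_ ?_ ?_
        hlen) ?_
      · simp [h8]
      · simp [h8, h₂]
      · simp
      · omega
      · intro j hj
        have := hget i (j + 1) (by simpa [tourCode] using hj)
        rw [add_assoc _ 1 j, add_comm 1 j, this]
        refine (congrArg (List.getD · (j + 1) 0) (tourCode_eq τ i)).trans ?_
        rw [List.getD_cons_succ, List.getD_eq_getElem _ _ (by simpa using hj),
          List.getElem_map]
      · rintro s' ⟨g9, hr', hp', g8, ho'⟩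
        refine ⟨by simpa [h9] using g9, ⟨hr', by rw [g8, hsucc]; omega, ?_⟩, ?_⟩
        · rw [remaining_succ]
          exact hp'
        · rw [ho']
          simp [h8, h₂, HVRP.expand]
  · rintro s' ⟨-, ho'⟩
    rw [ho', codeSolution_expand, ho]
    rfl

end Programs

/-! ### The running time -/

lemma length_le_bitLength (w : List ℕ) : w.length ≤ bitLength w := by
  induction w with
  | nil => exact Nat.zero_le _
  | cons x w ih =>
    simp only [bitLength, List.map_cons, List.sum_cons, List.length_cons] at *
    omega

lemma size_le_bitLength {w : List ℕ} {x : ℕ} (hx : x ∈ w) : x.size ≤ bitLength w := by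
  have := List.single_le_sum (l := w.map fun x => x.size + 1) (fun _ _ => Nat.zero_le _) _
    (List.mem_map_of_mem hx)
  unfold bitLength
  omega

lemma fits_initStore {w : List ℕ} {S : ℕ} (h : bitLength w ≤ S) : (initStore w).Fits S := by
  refine ⟨fun i => ?_, fun a => ?_⟩
  · have h₁ := (length_le_bitLength w).trans h
    have := S.lt_two_pow_self
    simp only [initStore]
    split_ifs <;> omega
  · simp only [initStore]
    rcases lt_or_ge a w.length with ha | ha
    · rw [List.getD_eq_getElem _ _ ha]
      exact Nat.size_le.1 ((size_le_bitLength (List.getElem_mem ha)).trans h)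
    · rw [List.getD_eq_default _ _ ha]
      positivity

lemma Runs.outputsWithin {S : ℕ} {c : Prog} {w o : List ℕ}
    (h : Runs S c (initStore w) fun s => s.out = o) (hS : bitLength w ≤ S) :
    c.OutputsWithin w o (c.costBound S) := by
  obtain ⟨s, t, h₁, h₂, -, h₃⟩ := h (fits_initStore hS)
  exact ⟨s, t, h₁, h₃, h₂⟩

/-- ⌈qQ'/Q⌉ ≤ ⌈q/Q⌉·Q' with scaled capacity Q' ≤ n^b. This is where scaling keeps the number of
copies polynomial although Q is given in binary. -/
lemma HVRP.scaledDemand_le (I : HVRP) (b : ℕ) (v : Fin I.n) :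
    I.scaledDemand b v ≤ ⌈(I.q v : ℚ) / I.Q⌉₊ * I.n ^ b := by
  have h₁ : I.q v ≤ I.Q * ((I.q v + I.Q - 1) / I.Q) := by
    rw [← ceilDiv_le_iff_le_mul I.Q_pos, Nat.ceilDiv_eq_add_pred_div]
  have h₂ : I.scaledCapacity b ≤ I.n ^ b := min_le_right _ _
  rw [scaledDemand_eq, ← Nat.ceilDiv_eq_add_pred_div, ceilDiv_le_iff_le_mul I.Q_pos,
    ceil_div_eq_ceilDiv _ I.Q_pos, ← mul_assoc]
  exact Nat.mul_le_mul h₁ h₂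

lemma HVRP.reduced_n_le (I : HVRP) (b : ℕ) : (I.reduced b).n ≤ 1 + I.loads * I.n ^ b := by
  have h : (I.reduced b).n = 1 + ∑ v, I.scaledDemand b v := by
    rw [← Fintype.card_fin (I.reduced b).n,
      Fintype.card_congr (pointEquiv I (I.scaledDemand b) (I.scaledCapacity b)),
      Fintype.card_option, Fintype.card_sigma, add_comm]
    simp
  rw [h, loads, Finset.sum_mul]
  exact Nat.add_le_add_left (Finset.sum_le_sum fun v _ => I.scaledDemand_le b v) 1

open Polynomial in
/-- A bound for the bit lengths and for the numbers of iterations. -/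
noncomputable def sizePolynomial (b : ℕ) : ℕ[X] := (X + 1) ^ (b + 1) + X

open Polynomial in
/-- A polynomial bound for the running time of a program. -/
noncomputable def Prog.costPolynomial (c : Prog) (b : ℕ) : ℕ[X] :=
  C c.weight * (sizePolynomial b + 2) ^ (c.depth + 1)

lemma Prog.eval_costPolynomial (c : Prog) (b x : ℕ) :
    (c.costPolynomial b).eval x = c.costBound ((sizePolynomial b).eval x) := by
  simp [costPolynomial, costBound]

lemma eval_sizePolynomial (b x : ℕ) : (sizePolynomial b).eval x = (x + 1) ^ (b + 1) + x := by
  simp [sizePolynomial]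

lemma HVRP.reduced_n_le_eval (I : HVRP) (b : ℕ) {x : ℕ} (hn : I.n ≤ x) (hloads : I.loads ≤ x) :
    (I.reduced b).n ≤ (sizePolynomial b).eval x := by
  have h₁ : I.n ^ b ≤ (x + 1) ^ b := Nat.pow_le_pow_left (by omega) b
  have h₂ : 1 ≤ (x + 1) ^ b := Nat.one_le_pow _ _ (by omega)
  calc (I.reduced b).n ≤ 1 + I.loads * I.n ^ b := I.reduced_n_le b
    _ ≤ (x + 1) ^ b + x * (x + 1) ^ b := add_le_add h₂ (Nat.mul_le_mul hloads h₁)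
    _ = (x + 1) ^ (b + 1) := by ring
    _ ≤ _ := by rw [eval_sizePolynomial]; exact Nat.le_add_right _ _

end HetVRP

open HetVRP
theorem mainTheorem5 :
    ∃ C : ℕ, ∀ b : ℕ, 1 ≤ b →
      ∃ (reduce convert : Prog) (p : Polynomial ℕ),
        ∀ I : HVRP, ∃ J : HTSP,
          -- `J` lives on the demand copies and can be constructed in polynomial time
          IsCopyInstance I (I.scaledDemand b) (I.scaledCapacity b) J ∧
          (∀ w, I.IsCode w →
            ∃ o, J.IsCode o ∧
              reduce.OutputsWithin w o (p.eval (bitLength w + I.loads))) ∧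
          J.opt ≤ C * I.opt ∧
          -- solutions of `J` can be converted in polynomial time
          ∀ τ : J.Solution, J.Feasible τ →
            ∃ σ : I.Solution, I.Feasible σ ∧ I.makespan σ ≤ C * J.makespan τ ∧
              ∀ w, I.IsCode w →
                convert.OutputsWithin (w ++ J.codeSolution τ) (I.codeSolution σ)
                  (p.eval (bitLength (w ++ J.codeSolution τ) + I.loads)) := by
  -- 8 is the larger of the factors 5 and 8, and the sum of the two cost polynomials bounds both
  -- programs.
  refine ⟨8, fun b hb => ⟨.reduce b, .convert b,
    (Prog.reduce b).costPolynomial b + (Prog.convert b).costPolynomial b,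
    fun I => ⟨I.reduced b, isCopyInstance_copyInstance I _ _, ?_, I.opt_reduced_le hb, ?_⟩⟩⟩
  · rintro w ⟨D, T, hD, hT, rfl⟩
    refine ⟨_, isCode_reducedCode hD hT, ?_⟩
    change (Prog.reduce b).OutputsWithin (instanceCode I D T) _
      (Polynomial.eval (bitLength (instanceCode I D T) + I.loads) _)
    set w := instanceCode I D T with hw
    have hL : Layout I D T w := by simpa [hw] using layout_append I D T []
    have h₁ := hL.length
    have h₂ := length_le_bitLength w
    have h₃ := eval_sizePolynomial b (bitLength w + I.loads)
    obtain ⟨s, t, h₄, h₅, h₆⟩ := (runs_reduce (b := b) hL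
      (I.reduced_n_le_eval b (x := bitLength w + I.loads) (by omega) (by omega))
      (by omega)).outputsWithin (by omega)
    refine ⟨s, t, h₄, h₅, h₆.trans ?_⟩
    rw [Polynomial.eval_add, Prog.eval_costPolynomial]
    exact Nat.le_add_right _ _
  · intro τ hτ
    refine ⟨HVRP.expand τ, HVRP.feasible_expand hτ, HVRP.makespan_expand_le hb τ, ?_⟩
    rintro w ⟨D, T, hD, hT, rfl⟩
    change (Prog.convert b).OutputsWithin (instanceCode I D T ++ (I.reduced b).codeSolution τ) _
      (Polynomial.eval (bitLength (instanceCode I D T ++ (I.reduced b).codeSolution τ) +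
        I.loads) _)
    set w := instanceCode I D T ++ (I.reduced b).codeSolution τ with hw
    have hL : Layout I D T w := layout_append I D T _
    have h₁ := hL.length
    have h₂ := length_le_bitLength w
    have h₃ := eval_sizePolynomial b (bitLength w + I.loads)
    obtain ⟨s, t, h₄, h₅, h₆⟩ := (runs_convert τ hw
      (I.reduced_n_le_eval b (x := bitLength w + I.loads) (by omega) (by omega))
      (by omega)).outputsWithin (by omega)
    refine ⟨s, t, h₄, h₅, h₆.trans ?_⟩
    rw [Polynomial.eval_add, Prog.eval_costPolynomial, Prog.eval_costPolynomial]
    exact Nat.le_add_left _ _
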